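/- Let $\Phi$ be a commutative unital ring containing $\frac12$. A Jordan pair $V=(V^+,V^-)$ over $\Phi$ is a pair of $\Phi$-modules with quadratic maps $Q^\sigma:V^\sigma\to\mathrm{Hom}_\Phi(V^{-\sigma},V^\sigma)$ ($\sigma=\pm$), with $\{x,y,z\}=D_{x,y}z=(Q_{x+z}-Q_x-Q_z)y$, such that $D_{x,y}Q_x=Q_xD_{y,x}$, $D_{Q_xy,y}=D_{x,Q_yx}$ and $Q_{Q_xy}=Q_xQ_yQ_x$ hold in all scalar extensions. It is semiprime if every ideal $I$ with $Q_{I^+}I^-=0$ and $Q_{I^-}I^+=0$ is zero. For an ideal $I$ of $V$, $\mathrm{Ann}_V(I)^\sigma$ is the set of all $z\in V^\sigma$ with $\{z,I^{-\sigma},V^\sigma\}=\{z,V^{-\sigma},I^\sigma\}=\{V^{-\sigma},z,I^{-\sigma}\}=0$. The Lie algebra $\mathrm{TKK}(V)$ is $V^+\oplus\mathrm{IDer}(V)\oplus V^-$, where $\mathrm{IDer}(V)$ is the span of all $\delta(x,y)=(D_{x,y},-D_{y,x})$, with product $$[x^+\oplus\gamma\oplus x^-,\,y^+\oplus\mu\oplus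 y^-]=(\gamma_+y^+-\mu_+x^+)\oplus([\gamma,\mu]+\delta(x^+,y^-)-\delta(y^+,x^-))\oplus(\gamma_-y^--\mu_-x^-).$$ A Jordan pair $W$ containing a semiprime Jordan pair $V$ as a subpair is a pair of $\mathfrak M$-quotients of $V$ if for each $\sigma=\pm$ and each $0\neq q\in W^\sigma$ there is an ideal $I$ of $V$ with $\mathrm{Ann}_V(I)=0$ such that $\{q,I^{-\sigma},V^\sigma\}+\{q,V^{-\sigma},I^\sigma\}\subseteq V^\sigma$ and $\{I^{-\sigma},q,V^{-\sigma}\}\subseteq V^{-\sigma}$, and at least one of $\{q,I^{-\sigma},V^\sigma\}+\{q,V^{-\sigma},I^\sigma\}$, $\{I^{-\sigma},q,V^{-\sigma}\}$ is nonzero. A Lie algebra $Q$ is an algebra of quotients of a subalgebra $L$ if for all $p,q\in Q$ with $p\neq0$ there is $x\in L$ with $[x,p]\neq0$ and $[x,{}_L(q)]\subseteq L$, where ${}_L(q)$ is the linear span of $q$ and of all $[x_1,[x_2,\dots,[x_n,q]\dots]]$ with $x_i\in L$. Theorem. Let $V$ be a semiprime subpair of a Jordan pair $W$ over $\Phi$.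 The following are equivalent: (i) $W$ is a pair of $\mathfrak M$-quotients of $V$; (ii) $\mathrm{TKK}(W)$ is an algebra of quotients of $\mathrm{TKK}(V)$; that is, the inclusions $V^\pm\subseteq W^\pm$ extend to an injective homomorphism of Lie algebras $\mathrm{TKK}(V)\to\mathrm{TKK}(W)$, and $\mathrm{TKK}(W)$ is an algebra of quotients of its image. -/

import Mathlib

open scoped TensorProduct

universe u v w v' w'

/-- The trilinear product `{x, y, z} = Q_{x,z} y` of a quadratic map `Q : P → Hom(M, P)`, where
`Q_{x,z} = Q_{x+z} - Q_x - Q_z`; thus `D_{x,y} z = {x, y, z}`. -/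
def quadTriple {K P M : Type*} [CommRing K] [AddCommGroup P] [Module K P] [AddCommGroup M]
    [Module K M] (Q : QuadraticMap K P (M →ₗ[K] P)) (x : P) (y : M) (z : P) : P :=
  QuadraticMap.polar Q x z y

/-- The extension of a quadratic map `Q : P → Hom(M, P)` to a commutative `Φ`-algebra `K`:
the (unique) `K`-quadratic map `K ⊗ P → Hom_K(K ⊗ M, K ⊗ P)` that sends `a ⊗ x` to
`a² • (id ⊗ Q x)`. -/
noncomputable def quadExtend {Φ : Type u} [CommRing Φ] [Invertible (2 : Φ)]
    (K : Type u) [CommRing K] [Algebra Φ K]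
    {P : Type v} {M : Type w} [AddCommGroup P] [Module Φ P] [AddCommGroup M] [Module Φ M]
    (Q : QuadraticMap Φ P (M →ₗ[Φ] P)) :
    QuadraticMap K (K ⊗[Φ] P) ((K ⊗[Φ] M) →ₗ[K] (K ⊗[Φ] P)) :=
  (LinearMap.liftBaseChange K (LinearMap.baseChangeHom Φ K M P)).compQuadraticMap
    ((QuadraticMap.sq (R := K)).tmul Q)

/-- The defining identities of a Jordan pair, for one choice of the sign `σ`:
* `D_{x,y} Q_x = Q_x D_{y,x}`,
* `D_{Q_x y, y} = D_{x, Q_y x}`,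
* `Q_{Q_x y} = Q_x Q_y Q_x`. -/
structure JordanIdentities {K P M : Type*} [CommRing K] [AddCommGroup P] [Module K P]
    [AddCommGroup M] [Module K M] (Qp : QuadraticMap K P (M →ₗ[K] P))
    (Qm : QuadraticMap K M (P →ₗ[K] M)) : Prop where
  jp1 : ∀ (x : P) (y z : M), quadTriple Qp x y (Qp x z) = Qp x (quadTriple Qm y x z)
  jp2 : ∀ (x : P) (y : M) (z : P), quadTriple Qp (Qp x y) y z = quadTriple Qp x (Qm y x) z
  jp3 : ∀ (x : P) (y z : M), Qp (Qp x y) z = Qp x (Qm y (Qp x z))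

/-- A Jordan pair `(P, M) = (V⁺, V⁻)` over a commutative ring `Φ` containing `1/2`: a pair of
quadratic maps `Q⁺ : V⁺ → Hom(V⁻, V⁺)`, `Q⁻ : V⁻ → Hom(V⁺, V⁻)` that satisfy the Jordan identities
(for both signs) in all scalar extensions. (It makes no difference that only extensions `K` in the
universe of `Φ` are used: these include the polynomial rings over `Φ`, for which the identities
are equivalent to the vanishing of all their linearizations, hence to their validity in every
scalar extension.) -/
structure JordanPair (Φ : Type u) [CommRing Φ] [Invertible (2 : Φ)] (P : Type v) (M : Type w)
    [AddCommGroup P] [Module Φ P] [AddCommGroup M] [Module Φ M] where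
  /-- the quadratic map `Q⁺` -/
  Q : QuadraticMap Φ P (M →ₗ[Φ] P)
  /-- the quadratic map `Q⁻` -/
  Qneg : QuadraticMap Φ M (P →ₗ[Φ] M)
  identities_pos : ∀ (K : Type u) [CommRing K] [Algebra Φ K],
    JordanIdentities (quadExtend K Q) (quadExtend K Qneg)
  identities_neg : ∀ (K : Type u) [CommRing K] [Algebra Φ K],
    JordanIdentities (quadExtend K Qneg) (quadExtend K Q)

section Extension

variable {Φ : Type u} [CommRing Φ] [Invertible (2 : Φ)]
  {P : Type v} {M : Type w} [AddCommGroup P] [Module Φ P] [AddCommGroup M] [Module Φ M]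

theorem quadExtend_tmul (K : Type u) [CommRing K] [Algebra Φ K]
    (Q : QuadraticMap Φ P (M →ₗ[Φ] P)) (a b : K) (x : P) (y : M) :
    quadExtend K Q (a ⊗ₜ x) (b ⊗ₜ y) = (a * a * b) ⊗ₜ Q x y := by
  simp [quadExtend, QuadraticMap.tensorDistrib_tmul, TensorProduct.smul_tmul']

theorem quadTriple_quadExtend (K : Type u) [CommRing K] [Algebra Φ K]
    (Q : QuadraticMap Φ P (M →ₗ[Φ] P)) (x z : P) (y : M) :
    quadTriple (quadExtend K Q) (1 ⊗ₜ x) (1 ⊗ₜ y) (1 ⊗ₜ z) = (1 : K) ⊗ₜ[Φ] quadTriple Q x y z := by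
  simp only [quadTriple, QuadraticMap.polar, LinearMap.sub_apply, ← TensorProduct.tmul_add,
    quadExtend_tmul, mul_one, ← TensorProduct.tmul_sub]

theorem one_tmul_inj {Φ : Type u} [CommRing Φ] {N : Type*} [AddCommGroup N] [Module Φ N] {x y : N}
    (h : (1 : Φ) ⊗ₜ[Φ] x = 1 ⊗ₜ[Φ] y) : x = y := by
  simpa using congrArg (TensorProduct.lid Φ N) h

theorem jordanIdentities_of_quadExtend {Qp : QuadraticMap Φ P (M →ₗ[Φ] P)}
    {Qm : QuadraticMap Φ M (P →ₗ[Φ] M)}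
    (h : JordanIdentities (quadExtend Φ Qp) (quadExtend Φ Qm)) : JordanIdentities Qp Qm where
  jp1 x y z := one_tmul_inj <| by
    simpa [quadExtend_tmul, quadTriple_quadExtend] using
      h.jp1 ((1 : Φ) ⊗ₜ x) ((1 : Φ) ⊗ₜ y) ((1 : Φ) ⊗ₜ z)
  jp2 x y z := one_tmul_inj <| by
    simpa [quadExtend_tmul, quadTriple_quadExtend] using
      h.jp2 ((1 : Φ) ⊗ₜ x) ((1 : Φ) ⊗ₜ y) ((1 : Φ) ⊗ₜ z)
  jp3 x y z := one_tmul_inj <| by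
    simpa [quadExtend_tmul] using h.jp3 ((1 : Φ) ⊗ₜ x) ((1 : Φ) ⊗ₜ y) ((1 : Φ) ⊗ₜ z)

end Extension

namespace JordanPair

section Basic

variable {Φ : Type u} [CommRing Φ] [Invertible (2 : Φ)]
  {P : Type v} {M : Type w} [AddCommGroup P] [Module Φ P] [AddCommGroup M] [Module Φ M]

/-- The opposite pair `(V⁻, V⁺)`. It serves to state the case `σ = -` of a notion by applying the
case `σ = +` to the opposite pair. -/
def op (V : JordanPair Φ P M) : JordanPair Φ M P where
  Q := V.Qneg
  Qneg := V.Q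
  identities_pos := V.identities_neg
  identities_neg := V.identities_pos

/-- The triple product `{x, y, z}` for `x, z ∈ V⁺`, `y ∈ V⁻`. The product `{y, x, t}` for
`y, t ∈ V⁻`, `x ∈ V⁺` is `V.op.triple y x t`. -/
def triple (V : JordanPair Φ P M) (x : P) (y : M) (z : P) : P := quadTriple V.Q x y z

theorem identities (V : JordanPair Φ P M) : JordanIdentities V.Q V.Qneg :=
  jordanIdentities_of_quadExtend (V.identities_pos Φ)

theorem triple_comm (V : JordanPair Φ P M) (x : P) (y : M) (z : P) :
    V.triple x y z = V.triple z y x := by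
  simp only [triple, quadTriple, QuadraticMap.polar_comm _ x z]

theorem triple_self (V : JordanPair Φ P M) (x : P) (y : M) :
    V.triple x y x = (2 : Φ) • V.Q x y := by
  simp only [triple, quadTriple, QuadraticMap.polar_self, LinearMap.smul_apply]
  rw [← Nat.cast_smul_eq_nsmul Φ]
  simp

theorem triple_add_left (V : JordanPair Φ P M) (x x' : P) (y : M) (z : P) :
    V.triple (x + x') y z = V.triple x y z + V.triple x' y z := by
  simp only [triple, quadTriple, QuadraticMap.polar_add_left, LinearMap.add_apply]

theorem triple_smul_left (V : JordanPair Φ P M) (a : Φ) (x : P) (y : M) (z : P) :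
    V.triple (a • x) y z = a • V.triple x y z := by
  simp only [triple, quadTriple, QuadraticMap.polar_smul_left, LinearMap.smul_apply]

theorem triple_add_right (V : JordanPair Φ P M) (x : P) (y : M) (z z' : P) :
    V.triple x y (z + z') = V.triple x y z + V.triple x y z' := by
  simp only [triple, quadTriple, QuadraticMap.polar_add_right, LinearMap.add_apply]

theorem triple_smul_right (V : JordanPair Φ P M) (a : Φ) (x : P) (y : M) (z : P) :
    V.triple x y (a • z) = a • V.triple x y z := by
  simp only [triple, quadTriple, QuadraticMap.polar_smul_right, LinearMap.smul_apply]

theorem triple_add_mid (V : JordanPair Φ P M) (x : P) (y y' : M) (z : P) :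
    V.triple x (y + y') z = V.triple x y z + V.triple x y' z := by
  simp only [triple, quadTriple, map_add]

theorem triple_smul_mid (V : JordanPair Φ P M) (a : Φ) (x : P) (y : M) (z : P) :
    V.triple x (a • y) z = a • V.triple x y z := by
  simp only [triple, quadTriple, map_smul]

theorem two_cancel {N : Type*} [AddCommGroup N] [Module Φ N] {x y : N}
    (h : x + x = y + y) : x = y := by
  rw [← two_smul Φ x, ← two_smul Φ y] at h
  have h2 := congrArg (fun t => (⅟2 : Φ) • t) h
  simpa [smul_smul] using h2

theorem triple_jp1 (V : JordanPair Φ P M) (x : P) (y z : M) :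
    V.triple x y (V.triple x z x) = V.triple x (V.op.triple y x z) x := by
  rw [triple_self, triple_self, triple_smul_right]
  exact congrArg _ (V.identities.jp1 x y z)

theorem triple_jp2 (V : JordanPair Φ P M) (x : P) (y : M) (z : P) :
    V.triple (V.triple x y x) y z = V.triple x (V.op.triple y x y) z := by
  rw [triple_self, triple_self, triple_smul_left, triple_smul_mid]
  exact congrArg _ (V.identities.jp2 x y z)

theorem triple_neg_left (V : JordanPair Φ P M) (x : P) (y : M) (z : P) :
    V.triple (-x) y z = -V.triple x y z := by
  simpa using V.triple_smul_left (-1) x y z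

theorem triple_neg_mid (V : JordanPair Φ P M) (x : P) (y : M) (z : P) :
    V.triple x (-y) z = -V.triple x y z := by
  simpa using V.triple_smul_mid (-1) x y z

theorem triple_neg_right (V : JordanPair Φ P M) (x : P) (y : M) (z : P) :
    V.triple x y (-z) = -V.triple x y z := by
  simpa using V.triple_smul_right (-1) x y z

theorem triple_jp1_lin (V : JordanPair Φ P M) (x z : P) (y v : M) :
    V.triple z y (V.triple x v x) + (V.triple x y (V.triple x v z) + V.triple x y (V.triple x v z))
      = V.triple x (V.op.triple y z v) x
        + (V.triple z (V.op.triple y x v) x + V.triple z (V.op.triple y x v) x) := by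
  have h1 := V.triple_jp1 (x + z) y v
  have h2 := V.triple_jp1 (x + -z) y v
  have h3 := V.triple_jp1 z y v
  simp only [triple_add_left, triple_add_right, triple_add_mid, triple_neg_left,
    triple_neg_mid, triple_neg_right,
    V.triple_comm z v x, V.triple_comm x (V.op.triple y x v) z,
    V.triple_comm x (V.op.triple y z v) z] at h1 h2 ⊢
  apply two_cancel (Φ := Φ)
  grind

/-- The derivation property of the inner derivations, in quadratic form. -/
theorem triple_jp12 (V : JordanPair Φ P M) (x z : P) (y v : M) :
    V.triple x y (V.triple z v z) + V.triple z (V.op.triple y x v) z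
      = V.triple (V.triple x y z) v z + V.triple (V.triple x y z) v z := by
  have h1 := V.triple_jp1_lin z x y v
  have key : ∀ a b : P, V.triple (V.triple a y a) v b + V.triple (V.triple a v a) y b
      = V.triple a (V.op.triple y a v) b + V.triple a (V.op.triple y a v) b := by
    intro a b
    have e1 := V.triple_jp2 a (y + v) b
    have e2 := V.triple_jp2 a y b
    have e3 := V.triple_jp2 a v b
    simp only [triple_add_left, triple_add_right, triple_add_mid,
      V.op.triple_comm v a y] at e1
    grind
  have k1 := key (x + z) z
  have k2 := key x z
  have k3 := key z z
  simp only [triple_add_left, triple_add_right, triple_add_mid] at k1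
  rw [V.triple_comm z y x, V.triple_comm z v x] at k1
  have h4 := V.triple_comm z y (V.triple x v z)
  have h5 := V.triple_comm z v x
  have h6 := V.triple_comm x (V.op.triple y z v) z
  rw [h5] at h1
  apply two_cancel (Φ := Φ)
  grind

/-- The derivation property of the inner derivations. -/
theorem triple_triple (V : JordanPair Φ P M) (x : P) (y : M) (z : P) (v : M) (t : P) :
    V.triple x y (V.triple z v t)
      = V.triple (V.triple x y z) v t - V.triple z (V.op.triple y x v) t
        + V.triple z v (V.triple x y t) := by
  have h1 := V.triple_jp12 x (z + t) y v
  have h2 := V.triple_jp12 x z y v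
  have h3 := V.triple_jp12 x t y v
  simp only [triple_add_left, triple_add_right] at h1
  rw [V.triple_comm t v z, V.triple_comm t _ z, V.triple_comm (V.triple x y t) v z] at h1
  apply two_cancel (Φ := Φ)
  grind

/-- The operator `D_{x,y} : V⁺ → V⁺`, `z ↦ {x, y, z}`. -/
def D (V : JordanPair Φ P M) (x : P) (y : M) : Module.End Φ P where
  toFun z := V.triple x y z
  map_add' := V.triple_add_right x y
  map_smul' a z := V.triple_smul_right a x y z

/-- The inner derivation `δ(x, y) = (D_{x,y}, -D_{y,x})`. -/
def δ (V : JordanPair Φ P M) (x : P) (y : M) : Module.End Φ P × Module.End Φ M :=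
  (V.D x y, -V.op.D y x)

/-- The module `IDer V` spanned by the inner derivations. -/
def IDer (V : JordanPair Φ P M) : Submodule Φ (Module.End Φ P × Module.End Φ M) :=
  Submodule.span Φ {d | ∃ (x : P) (y : M), d = V.δ x y}

theorem D_apply (V : JordanPair Φ P M) (x : P) (y : M) (z : P) : V.D x y z = V.triple x y z := rfl

theorem δ_mem (V : JordanPair Φ P M) (x : P) (y : M) : V.δ x y ∈ V.IDer :=
  Submodule.subset_span ⟨x, y, rfl⟩

theorem δ_add_left (V : JordanPair Φ P M) (x x' : P) (y : M) :
    V.δ (x + x') y = V.δ x y + V.δ x' y := by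
  ext t <;> simp [δ, D_apply, triple_add_left, triple_add_mid, add_comm]

theorem δ_add_right (V : JordanPair Φ P M) (x : P) (y y' : M) :
    V.δ x (y + y') = V.δ x y + V.δ x y' := by
  ext t <;> simp [δ, D_apply, triple_add_left, triple_add_mid, add_comm]

theorem δ_smul_left (V : JordanPair Φ P M) (a : Φ) (x : P) (y : M) :
    V.δ (a • x) y = a • V.δ x y := by
  ext t <;> simp [δ, D_apply, triple_smul_left, triple_smul_mid]

theorem δ_smul_right (V : JordanPair Φ P M) (a : Φ) (x : P) (y : M) :
    V.δ x (a • y) = a • V.δ x y := by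
  ext t <;> simp [δ, D_apply, triple_smul_left, triple_smul_mid]

/-- `[γ, δ(x, y)] = δ(γ⁺ x, y) + δ(x, γ⁻ y)` for inner derivations `γ`. -/
theorem comm_δ (V : JordanPair Φ P M) {γ : Module.End Φ P × Module.End Φ M} (hγ : γ ∈ V.IDer)
    (x : P) (y : M) : γ * V.δ x y - V.δ x y * γ = V.δ (γ.1 x) y + V.δ x (γ.2 y) := by
  induction hγ using Submodule.span_induction with
  | mem d hd =>
    obtain ⟨a, b, rfl⟩ := hd
    ext t
    · have h := V.triple_triple a b x y t
      simp only [δ, D_apply, Prod.fst_mul, Prod.fst_sub, Prod.fst_add, LinearMap.sub_apply,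
        Module.End.mul_apply, LinearMap.add_apply, LinearMap.neg_apply, triple_neg_mid, h]
      abel
    · have h := V.op.triple_triple b a y x t
      have h' : V.op.op = V := rfl
      rw [h'] at h
      simp only [δ, D_apply, Prod.snd_mul, Prod.snd_sub, Prod.snd_add, LinearMap.sub_apply,
        Module.End.mul_apply, LinearMap.add_apply, LinearMap.neg_apply, triple_neg_left,
        triple_neg_right, h]
      abel
  | zero =>
    have h1 : V.δ 0 y = 0 := by simpa using V.δ_smul_left 0 0 y
    have h2 : V.δ x 0 = 0 := by simpa using V.δ_smul_right 0 x 0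
    simp [h1, h2]
  | add γ γ' _ _ h h' =>
    rw [Prod.fst_add, Prod.snd_add, LinearMap.add_apply, LinearMap.add_apply, δ_add_left,
      δ_add_right, add_mul, mul_add]
    have := congrArg₂ (· + ·) h h'
    calc _ = _ := by abel
      _ = _ := this
      _ = _ := by abel
  | smul a γ _ h =>
    rw [Prod.smul_fst, Prod.smul_snd, LinearMap.smul_apply, LinearMap.smul_apply, δ_smul_left,
      δ_smul_right, smul_mul_assoc, mul_smul_comm, ← smul_sub, h, smul_add]

theorem comm_mem_IDer (V : JordanPair Φ P M) {γ μ : Module.End Φ P × Module.End Φ M}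
    (hγ : γ ∈ V.IDer) (hμ : μ ∈ V.IDer) : γ * μ - μ * γ ∈ V.IDer := by
  induction hμ using Submodule.span_induction with
  | mem d hd =>
    obtain ⟨a, b, rfl⟩ := hd
    rw [comm_δ V hγ]
    exact add_mem (V.δ_mem _ _) (V.δ_mem _ _)
  | zero => simp
  | add μ μ' _ _ h h' =>
    have : γ * (μ + μ') - (μ + μ') * γ = (γ * μ - μ * γ) + (γ * μ' - μ' * γ) := by
      rw [mul_add, add_mul]; abel
    rw [this]; exact add_mem h h'
  | smul a μ _ h =>
    rw [smul_mul_assoc, mul_smul_comm, ← smul_sub]; exact Submodule.smul_mem _ _ h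

/-- The module `TKK(V) = V⁺ ⊕ IDer V ⊕ V⁻`. -/
def TKK (V : JordanPair Φ P M) : Type (max v w) := P × V.IDer × M

namespace TKK

variable {V : JordanPair Φ P M}

instance : AddCommGroup V.TKK := inferInstanceAs (AddCommGroup (P × V.IDer × M))

instance : Module Φ V.TKK := inferInstanceAs (Module Φ (P × V.IDer × M))

/-- The component in `V⁺` of an element of `TKK(V)`. -/
def pos (a : V.TKK) : P := a.1

/-- The component in `IDer V` of an element of `TKK(V)`, as a pair of endomorphisms. -/
def der (a : V.TKK) : Module.End Φ P × Module.End Φ M := a.2.1.1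

/-- The component in `V⁻` of an element of `TKK(V)`. -/
def neg (a : V.TKK) : M := a.2.2

theorem der_mem (a : V.TKK) : a.der ∈ V.IDer := a.2.1.2

/-- The element `x ⊕ γ ⊕ y` of `TKK(V)`. -/
def mk (x : P) (γ : Module.End Φ P × Module.End Φ M) (hγ : γ ∈ V.IDer) (y : M) : V.TKK :=
  (x, ⟨γ, hγ⟩, y)

/-- The inclusion of `V⁺` in `TKK(V)`. -/
def ofPos (V : JordanPair Φ P M) (x : P) : V.TKK := mk x 0 (zero_mem _) 0

/-- The inclusion of `V⁻` in `TKK(V)`. -/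
def ofNeg (V : JordanPair Φ P M) (y : M) : V.TKK := mk 0 0 (zero_mem _) y

@[ext] theorem ext {a b : V.TKK} (h1 : a.pos = b.pos) (h2 : a.der = b.der) (h3 : a.neg = b.neg) :
    a = b :=
  Prod.ext h1 (Prod.ext (Subtype.ext h2) h3)

@[simp] theorem pos_add (a b : V.TKK) : (a + b).pos = a.pos + b.pos := rfl
@[simp] theorem der_add (a b : V.TKK) : (a + b).der = a.der + b.der := rfl
@[simp] theorem neg_add (a b : V.TKK) : (a + b).neg = a.neg + b.neg := rfl
@[simp] theorem pos_zero : (0 : V.TKK).pos = 0 := rfl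
@[simp] theorem der_zero : (0 : V.TKK).der = 0 := rfl
@[simp] theorem neg_zero : (0 : V.TKK).neg = 0 := rfl
@[simp] theorem pos_smul (r : Φ) (a : V.TKK) : (r • a).pos = r • a.pos := rfl
@[simp] theorem der_smul (r : Φ) (a : V.TKK) : (r • a).der = r • a.der := rfl
@[simp] theorem neg_smul (r : Φ) (a : V.TKK) : (r • a).neg = r • a.neg := rfl

/-- The product
`[x⁺ ⊕ γ ⊕ x⁻, y⁺ ⊕ μ ⊕ y⁻]
  = (γ⁺ y⁺ - μ⁺ x⁺) ⊕ ([γ, μ] + δ(x⁺, y⁻) - δ(y⁺, x⁻)) ⊕ (γ⁻ y⁻ - μ⁻ x⁻)`. -/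
instance : Bracket V.TKK V.TKK where
  bracket a b := mk
    (a.der.1 b.pos - b.der.1 a.pos)
    ((a.der * b.der - b.der * a.der) + V.δ a.pos b.neg - V.δ b.pos a.neg)
    (sub_mem (add_mem (V.comm_mem_IDer a.der_mem b.der_mem) (V.δ_mem _ _)) (V.δ_mem _ _))
    (a.der.2 b.neg - b.der.2 a.neg)

@[simp] theorem pos_lie (a b : V.TKK) : ⁅a, b⁆.pos = a.der.1 b.pos - b.der.1 a.pos := rfl
@[simp] theorem der_lie (a b : V.TKK) :
    ⁅a, b⁆.der = (a.der * b.der - b.der * a.der) + V.δ a.pos b.neg - V.δ b.pos a.neg := rfl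
@[simp] theorem neg_lie (a b : V.TKK) : ⁅a, b⁆.neg = a.der.2 b.neg - b.der.2 a.neg := rfl

theorem δ_neg_left (x : P) (y : M) : V.δ (-x) y = -V.δ x y := by
  simpa using V.δ_smul_left (-1) x y

theorem δ_neg_right (x : P) (y : M) : V.δ x (-y) = -V.δ x y := by
  simpa using V.δ_smul_right (-1) x y

instance : LieRing V.TKK where
  add_lie a b c := by
    ext1
    · simp only [pos_lie, pos_add, der_add, Prod.fst_add, LinearMap.add_apply, map_add]; abel
    · simp only [der_lie, pos_add, der_add, neg_add, add_mul, mul_add, δ_add_left, δ_add_right]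
      abel
    · simp only [neg_lie, neg_add, der_add, Prod.snd_add, LinearMap.add_apply, map_add]; abel
  lie_add a b c := by
    ext1
    · simp only [pos_lie, pos_add, der_add, Prod.fst_add, LinearMap.add_apply, map_add]; abel
    · simp only [der_lie, pos_add, der_add, neg_add, add_mul, mul_add, δ_add_left, δ_add_right]
      abel
    · simp only [neg_lie, neg_add, der_add, Prod.snd_add, LinearMap.add_apply, map_add]; abel
  lie_self a := by
    ext1 <;> simp
  leibniz_lie a b c := by
    have hd : ∀ (x y : P) (t : M), (V.δ x t).1 y = (V.δ y t).1 x := fun x y t =>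
      V.triple_comm x t y
    have hd' : ∀ (x : P) (t s : M), (V.δ x t).2 s = (V.δ x s).2 t := fun x t s =>
      congrArg Neg.neg (V.op.triple_comm t x s)
    have hc : ∀ (d : V.TKK) (x : P) (y : M),
        d.der * V.δ x y = V.δ x y * d.der + (V.δ (d.der.1 x) y + V.δ x (d.der.2 y)) :=
      fun d x y => by rw [← V.comm_δ d.der_mem x y]; abel
    ext1
    · have h1 := hd a.pos b.pos c.neg
      have h2 := hd a.pos c.pos b.neg
      have h3 := hd b.pos c.pos a.neg
      simp only [pos_lie, pos_add, der_lie, Prod.fst_add, Prod.fst_sub, Prod.fst_mul,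
        LinearMap.add_apply, LinearMap.sub_apply, Module.End.mul_apply, map_sub]
      grind
    · simp only [pos_lie, der_add, der_lie, neg_lie, sub_eq_add_neg, δ_add_left, δ_add_right,
        δ_neg_left, δ_neg_right, add_mul, mul_add, neg_mul, mul_neg, hc, mul_assoc]
      abel
    · have h1 := hd' a.pos b.neg c.neg
      have h2 := hd' b.pos a.neg c.neg
      have h3 := hd' c.pos a.neg b.neg
      simp only [neg_lie, neg_add, der_lie, Prod.snd_add, Prod.snd_sub, Prod.snd_mul,
        LinearMap.add_apply, LinearMap.sub_apply, Module.End.mul_apply, map_sub]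
      grind

instance : LieAlgebra Φ V.TKK where
  lie_smul r a b := by
    ext1
    · simp only [pos_lie, pos_smul, der_smul, Prod.smul_fst, LinearMap.smul_apply, map_smul,
        smul_sub]
    · simp only [der_lie, pos_smul, der_smul, neg_smul, δ_smul_left, δ_smul_right,
        mul_smul_comm, smul_mul_assoc, smul_sub, smul_add]
    · simp only [neg_lie, neg_smul, der_smul, Prod.smul_snd, LinearMap.smul_apply, map_smul,
        smul_sub]

end TKK

/-- The part of the definition of an ideal `(I⁺, I⁻)` of a Jordan pair that concerns `I⁺`:
`Q_{I⁺} V⁻ ⊆ I⁺`, `Q_{V⁺} I⁻ ⊆ I⁺` and `{V⁺, V⁻, I⁺} ⊆ I⁺`. -/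
structure IsIdealPos (V : JordanPair Φ P M) (I : Submodule Φ P) (J : Submodule Φ M) : Prop where
  Q_mem_left : ∀ x ∈ I, ∀ y, V.Q x y ∈ I
  Q_mem_right : ∀ x, ∀ y ∈ J, V.Q x y ∈ I
  triple_mem : ∀ x y, ∀ z ∈ I, V.triple x y z ∈ I

/-- An ideal `(I⁺, I⁻)` of a Jordan pair. -/
structure Ideal (V : JordanPair Φ P M) where
  /-- the submodule `I⁺` of `V⁺` -/
  pos : Submodule Φ P
  /-- the submodule `I⁻` of `V⁻` -/
  neg : Submodule Φ M
  isIdeal_pos : V.IsIdealPos pos neg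
  isIdeal_neg : V.op.IsIdealPos neg pos

/-- `V` is semiprime if `Q_{I⁺} I⁻ = 0` and `Q_{I⁻} I⁺ = 0` imply `I = 0` for each ideal `I`. -/
def IsSemiprime (V : JordanPair Φ P M) : Prop :=
  ∀ I : V.Ideal, (∀ x ∈ I.pos, ∀ y ∈ I.neg, V.Q x y = 0) →
    (∀ y ∈ I.neg, ∀ x ∈ I.pos, V.op.Q y x = 0) → I.pos = ⊥ ∧ I.neg = ⊥

/-- The component in `V⁺` of the annihilator of `X = (X⁺, X⁻)`: all `z ∈ V⁺` with
`{z, X⁻, V⁺} = {z, V⁻, X⁺} = {V⁻, z, X⁻} = 0`. -/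
def annPos (V : JordanPair Φ P M) (Xp : Set P) (Xm : Set M) : Set P :=
  {z | (∀ b ∈ Xm, ∀ v, V.triple z b v = 0) ∧ (∀ t, ∀ a ∈ Xp, V.triple z t a = 0) ∧
    (∀ t, ∀ b ∈ Xm, V.op.triple t z b = 0)}

/-- The annihilator of the ideal `I` in `V` is zero. -/
def Ideal.AnnEqZero {V : JordanPair Φ P M} (I : V.Ideal) : Prop :=
  V.annPos I.pos I.neg = {0} ∧ V.op.annPos I.neg I.pos = {0}

end Basic

section Quotients

variable {Φ : Type u} [CommRing Φ] [Invertible (2 : Φ)]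
  {P : Type v} {M : Type w} [AddCommGroup P] [Module Φ P] [AddCommGroup M] [Module Φ M]
  {P' : Type v'} {M' : Type w'} [AddCommGroup P'] [Module Φ P'] [AddCommGroup M'] [Module Φ M']

/-- An inclusion of a Jordan pair `V` as a subpair of a Jordan pair `W`: a pair of injective
linear maps `V⁺ → W⁺`, `V⁻ → W⁻` that are compatible with the quadratic maps. -/
structure Inclusion (V : JordanPair Φ P M) (W : JordanPair Φ P' M') where
  /-- the inclusion `V⁺ → W⁺` -/
  pos : P →ₗ[Φ] P'
  /-- the inclusion `V⁻ → W⁻` -/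
  neg : M →ₗ[Φ] M'
  pos_injective : Function.Injective pos
  neg_injective : Function.Injective neg
  map_Q : ∀ x y, pos (V.Q x y) = W.Q (pos x) (neg y)
  map_Qneg : ∀ y x, neg (V.Qneg y x) = W.Qneg (neg y) (pos x)

/-- The same inclusion between the opposite pairs. -/
def Inclusion.op {V : JordanPair Φ P M} {W : JordanPair Φ P' M'} (i : Inclusion V W) :
    Inclusion V.op W.op where
  pos := i.neg
  neg := i.pos
  pos_injective := i.neg_injective
  neg_injective := i.pos_injective
  map_Q := i.map_Qneg
  map_Qneg := i.map_Q

/-- The condition on the elements of `W⁺` in the definition of a pair of `𝔐`-quotients: for each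
`0 ≠ q ∈ W⁺` there is an ideal `I` of `V` with zero annihilator such that
`{q, I⁻, V⁺} + {q, V⁻, I⁺} ⊆ V⁺` and `{I⁻, q, V⁻} ⊆ V⁻`, and one of
`{q, I⁻, V⁺} + {q, V⁻, I⁺}` and `{I⁻, q, V⁻}` is nonzero. -/
def Inclusion.AbsorbsPos {V : JordanPair Φ P M} {W : JordanPair Φ P' M'}
    (i : Inclusion V W) : Prop :=
  ∀ q : P', q ≠ 0 → ∃ I : V.Ideal, I.AnnEqZero ∧
    (∀ b ∈ I.neg, ∀ x, W.triple q (i.neg b) (i.pos x) ∈ i.pos.range) ∧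
    (∀ y, ∀ a ∈ I.pos, W.triple q (i.neg y) (i.pos a) ∈ i.pos.range) ∧
    (∀ b ∈ I.neg, ∀ y, W.op.triple (i.neg b) q (i.neg y) ∈ i.neg.range) ∧
    ((∃ b ∈ I.neg, ∃ x, W.triple q (i.neg b) (i.pos x) ≠ 0) ∨
     (∃ y, ∃ a ∈ I.pos, W.triple q (i.neg y) (i.pos a) ≠ 0) ∨
     (∃ b ∈ I.neg, ∃ y, W.op.triple (i.neg b) q (i.neg y) ≠ 0))

/-- `W` is a pair of `𝔐`-quotients of its (semiprime) subpair `V`. -/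
def IsPairOfMQuotients {V : JordanPair Φ P M} {W : JordanPair Φ P' M'}
    (i : Inclusion V W) : Prop :=
  i.AbsorbsPos ∧ i.op.AbsorbsPos

end Quotients

end JordanPair

/-- The linear span `_L(q)` of `q` and of the elements `ad x₁ ⋯ ad xₙ q` with `xᵢ ∈ L`. -/
def LieSubalgebra.adSpan {Φ Q : Type*} [CommRing Φ] [LieRing Q] [LieAlgebra Φ Q]
    (L : LieSubalgebra Φ Q) (q : Q) : Submodule Φ Q :=
  Submodule.span Φ {m | ∃ l : List L, m = l.foldr (fun x t => ⁅(x : Q), t⁆) q}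

/-- `Q` is an algebra of quotients of its subalgebra `L`: for all `p ≠ 0` and `q` in `Q` there is
`x ∈ L` with `[x, p] ≠ 0` and `[x, _L(q)] ⊆ L`. -/
def LieSubalgebra.IsAlgebraOfQuotients {Φ Q : Type*} [CommRing Φ] [LieRing Q] [LieAlgebra Φ Q]
    (L : LieSubalgebra Φ Q) : Prop :=
  ∀ p q : Q, p ≠ 0 → ∃ x ∈ L, ⁅x, p⁆ ≠ 0 ∧ ∀ m ∈ L.adSpan q, ⁅x, m⁆ ∈ L

/-! Call an ideal $K$ of $V$ dense if $\mathrm{Ann}_V(K)=0$. Semiprimeness gives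
$K\cap\mathrm{Ann}_V(K)=0$; hence dense ideals are closed under intersection and under the square
$K^2=\{K,K,V\}+\{K,V,K\}$ (`AnnEqZero.inter`, `AnnEqZero.sq`). Inside $T=\mathrm{TKK}(W)$ let $L$ be
the subalgebra generated by $V$, and let $\tilde K=K^++[K^+,V^-]+[V^+,K^-]+K^-$, an ideal of $L$.
The inclusion $\widetilde{K^2}\subseteq[\tilde K,\tilde K]$ (`tilde_sq_le`) transfers density
arguments from $V$ to $L$.

From (i) to (ii). The elements $t\in T$ with $[\tilde K,t]\subseteq L$ for some dense $K$ form a Lie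
subalgebra (`Absorbed.lie`). It contains $W^\pm$ (`absorbed_e`), which generate $T$, so it is all of
$T$. Moreover, no nonzero element of $T$ is annihilated by $\tilde K$ for a dense $K$
(`eq_zero_of_lie_eq_zero`). The latter shows that a combination of the $\delta(x,y)$, $x,y\in V$, is
determined on $W$ by its action on $V$, so $\mathrm{TKK}(V)$ embeds in $T$ with image $L$. For
$p\ne0$ and $q$ in $T$, an element of $\tilde K$ that moves $p$, with $K$ absorbing $q$, is the
required $x$.

From (ii) to (i). For homogeneous $q\in W^\pm$ put $N=\{x\in L:[x,{}_L(q)]\subseteq L\}$. This is a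
graded ideal of $L$, and by (ii) no nonzero element of $T$ commutes with $N$. The ideal $I=N\cap V$
is the one sought. Both its density and the nonvanishing of one of its products with $q$ rest on one
argument (`Separating.eq_zero_of_lie`): if $\tilde I$ kills $z\in W^+$, only the degree-zero part
$d$ of an element of $N$ can move $z$; if $[d,z]\in L$, it lies in $V^+$ and is again killed by
$\tilde I$, so it lies in $\mathrm{Ann}_V(I)$.

Signs are exchanged by passing to opposite pairs; $\tilde K$ and $L$ do not change. -/

namespace JordanPair

/-! ### Annihilators, intersections and squares of ideals in a semiprime Jordan pair -/

section Ideals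

variable {Φ : Type u} [CommRing Φ] [Invertible (2 : Φ)]
  {P : Type v} {M : Type w} [AddCommGroup P] [Module Φ P] [AddCommGroup M] [Module Φ M]
  {V : JordanPair Φ P M}

theorem op_op (V : JordanPair Φ P M) : V.op.op = V := rfl

theorem Q_eq_half_triple (V : JordanPair Φ P M) (x : P) (y : M) :
    V.Q x y = (⅟2 : Φ) • V.triple x y x := by
  rw [triple_self, smul_smul, invOf_mul_self, one_smul]

theorem triple_zero_left (V : JordanPair Φ P M) (y : M) (z : P) : V.triple 0 y z = 0 := by
  simpa using V.triple_smul_left 0 0 y z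

theorem triple_zero_mid (V : JordanPair Φ P M) (x z : P) : V.triple x 0 z = 0 := by
  simpa using V.triple_smul_mid 0 x 0 z

theorem triple_zero_right (V : JordanPair Φ P M) (x : P) (y : M) : V.triple x y 0 = 0 := by
  simpa using V.triple_smul_right 0 x y 0

/-- The derivation identity solved for its middle term, used to expand a product whose middle factor
is itself a product. -/
theorem triple_eq_mid (V : JordanPair Φ P M) (x z t : P) (y v : M) :
    V.triple z (V.op.triple y x v) t
      = V.triple (V.triple x y z) v t + V.triple z v (V.triple x y t)
        - V.triple x y (V.triple z v t) := by
  rw [triple_triple V x y z v t]; abel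

/-- Since $2$ is invertible, $Q_xy=\frac12\{x,y,x\}$, so ideals can be tested on triple products
alone. -/
theorem isIdealPos_of_triple {I : Submodule Φ P} {J : Submodule Φ M}
    (h1 : ∀ x y, ∀ z ∈ I, V.triple x y z ∈ I) (h2 : ∀ x, ∀ y ∈ J, ∀ z, V.triple x y z ∈ I) :
    V.IsIdealPos I J where
  Q_mem_left x hx y := by
    rw [Q_eq_half_triple]; exact I.smul_mem _ (h1 _ _ _ hx)
  Q_mem_right x y hy := by
    rw [Q_eq_half_triple]; exact I.smul_mem _ (h2 _ _ hy _)
  triple_mem := h1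

namespace Ideal

/-- The same ideal in the opposite pair. -/
def op (I : V.Ideal) : V.op.Ideal where
  pos := I.neg
  neg := I.pos
  isIdeal_pos := I.isIdeal_neg
  isIdeal_neg := I.isIdeal_pos

theorem triple_mem_right (I : V.Ideal) (x : P) (y : M) {z : P} (hz : z ∈ I.pos) :
    V.triple x y z ∈ I.pos :=
  I.isIdeal_pos.triple_mem x y z hz

theorem triple_mem_left (I : V.Ideal) {x : P} (hx : x ∈ I.pos) (y : M) (z : P) :
    V.triple x y z ∈ I.pos := by
  rw [triple_comm]; exact I.triple_mem_right _ _ hx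

theorem triple_mem_mid (I : V.Ideal) (x : P) {y : M} (hy : y ∈ I.neg) (z : P) :
    V.triple x y z ∈ I.pos := by
  simp only [triple, quadTriple, QuadraticMap.polar, LinearMap.sub_apply]
  exact sub_mem (sub_mem (I.isIdeal_pos.Q_mem_right _ _ hy) (I.isIdeal_pos.Q_mem_right _ _ hy))
    (I.isIdeal_pos.Q_mem_right _ _ hy)

/-- The ideal `V` of `V`. -/
def total (V : JordanPair Φ P M) : V.Ideal where
  pos := ⊤
  neg := ⊤
  isIdeal_pos := isIdealPos_of_triple (by simp) (by simp)
  isIdeal_neg := isIdealPos_of_triple (by simp) (by simp)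

/-- The intersection of two ideals. -/
def inter (I J : V.Ideal) : V.Ideal where
  pos := I.pos ⊓ J.pos
  neg := I.neg ⊓ J.neg
  isIdeal_pos := isIdealPos_of_triple
    (fun x y _ hz => ⟨I.triple_mem_right x y hz.1, J.triple_mem_right x y hz.2⟩)
    (fun x _ hy z => ⟨I.triple_mem_mid x hy.1 z, J.triple_mem_mid x hy.2 z⟩)
  isIdeal_neg := isIdealPos_of_triple
    (fun x y _ hz => ⟨I.op.triple_mem_right x y hz.1, J.op.triple_mem_right x y hz.2⟩)
    (fun x _ hy z => ⟨I.op.triple_mem_mid x hy.1 z, J.op.triple_mem_mid x hy.2 z⟩)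

/-- The positive part of the annihilator of an ideal, as a submodule. -/
def annSubmodule (I : V.Ideal) : Submodule Φ P where
  carrier := V.annPos I.pos I.neg
  add_mem' := fun {a b} ha hb => ⟨
    fun y hy v => by rw [triple_add_left, ha.1 y hy, hb.1 y hy, add_zero],
    fun t x hx => by rw [triple_add_left, ha.2.1 t x hx, hb.2.1 t x hx, add_zero],
    fun t y hy => by rw [triple_add_mid, ha.2.2 t y hy, hb.2.2 t y hy, add_zero]⟩
  zero_mem' := ⟨fun _ _ _ => V.triple_zero_left _ _, fun _ _ _ => V.triple_zero_left _ _,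
    fun _ _ _ => V.op.triple_zero_mid _ _⟩
  smul_mem' := fun c a ha => ⟨
    fun y hy v => by rw [triple_smul_left, ha.1 y hy, smul_zero],
    fun t x hx => by rw [triple_smul_left, ha.2.1 t x hx, smul_zero],
    fun t y hy => by rw [triple_smul_mid, ha.2.2 t y hy, smul_zero]⟩

/-- The derivation identity moves the factors from $V$ onto the element of $I$, which stays in $I$
and is then killed by the annihilator element. -/
theorem isIdealPos_annSubmodule (I : V.Ideal) :
    V.IsIdealPos I.annSubmodule I.op.annSubmodule := by
  refine isIdealPos_of_triple ?_ ?_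
  · rintro x y z ⟨h1, h2, h3⟩
    refine ⟨fun b hb v => ?_, fun t a ha => ?_, fun t b hb => ?_⟩
    · have h := V.triple_triple x y z b v
      rw [h1 b hb v, h1 _ (I.op.triple_mem_right y x hb), h1 b hb, triple_zero_right] at h
      simpa using h.symm
    · have h := V.triple_triple x y z t a
      rw [h2 t a ha, h2 _ a ha, h2 t _ (I.triple_mem_right x y ha), triple_zero_right] at h
      simpa using h.symm
    · have h := V.op.triple_triple y x t z b
      rw [h3 t b hb, h3 _ b hb, h3 t _ (I.op.triple_mem_right y x hb), triple_zero_right] at h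
      simpa [op_op] using h.symm
  · rintro x z ⟨h1, h2, h3⟩ v
    have h1' : ∀ a ∈ I.pos, ∀ y, V.op.triple z a y = 0 := h1
    have h2' : ∀ t, ∀ b ∈ I.neg, V.op.triple z t b = 0 := h2
    have h2'' : ∀ t, ∀ b ∈ I.neg, V.op.triple b t z = 0 := fun t b hb => by
      rw [triple_comm]; exact h2' t b hb
    have h3' : ∀ t, ∀ a ∈ I.pos, V.triple t z a = 0 := h3
    have h3'' : ∀ t, ∀ a ∈ I.pos, V.triple a z t = 0 := fun t a ha => by
      rw [triple_comm]; exact h3' t a ha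
    refine ⟨fun b hb w => ?_, fun t a ha => ?_, fun t b hb => ?_⟩
    · rw [triple_comm, triple_triple, h3'' _ _ (I.triple_mem_mid w hb x), h2'' _ _ hb,
        h3' _ _ (I.triple_mem_mid w hb v), triple_zero_mid]
      simp
    · have h : V.op.triple t a z = 0 := by rw [triple_comm]; exact h1' _ ha _
      rw [triple_comm, triple_triple, h3'' _ _ (I.triple_mem_left ha _ _), h,
        h3' _ _ (I.triple_mem_left ha _ _), triple_zero_mid]
      simp
    · have h := V.op.triple_triple z x t v b
      -- One application of the identity only gives $\{t,\{x,z,v\},b\}=\{\{z,x,t\},v,b\}$; a second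
      -- one, with $\{b,v,\cdot\}$ as the derivation, kills the right-hand side.
      have h' : V.op.triple (V.op.triple z x t) v b = 0 := by
        rw [triple_comm, triple_triple, op_op, h2'' _ _ hb, h2' _ _ (I.op.triple_mem_left hb _ _),
          h1' _ (I.triple_mem_mid v hb x), triple_zero_left]
        simp
      rw [h2' _ _ (I.op.triple_mem_right t v hb), h', h2' _ _ hb, triple_zero_right, op_op] at h
      simpa using h.symm

/-- The annihilator of an ideal. -/
def ann (I : V.Ideal) : V.Ideal where
  pos := I.annSubmodule
  neg := I.op.annSubmodule
  isIdeal_pos := I.isIdealPos_annSubmodule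
  isIdeal_neg := I.op.isIdealPos_annSubmodule

/-- The property of an ideal of being zero. -/
def IsZero (I : V.Ideal) : Prop := I.pos = ⊥ ∧ I.neg = ⊥

theorem IsZero.op {I : V.Ideal} (h : I.IsZero) : I.op.IsZero := ⟨h.2, h.1⟩

theorem annEqZero_iff (I : V.Ideal) : I.AnnEqZero ↔ I.ann.IsZero := by
  refine and_congr ?_ ?_
  · rw [← SetLike.coe_set_eq (p := I.ann.pos)]; exact Iff.rfl
  · rw [← SetLike.coe_set_eq (p := I.ann.neg)]; exact Iff.rfl

theorem IsZero.of_le {I J : V.Ideal} (hJ : J.IsZero) (h1 : I.pos ≤ J.pos) (h2 : I.neg ≤ J.neg) :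
    I.IsZero :=
  ⟨le_bot_iff.1 (h1.trans hJ.1.le), le_bot_iff.1 (h2.trans hJ.2.le)⟩

theorem isZero_of_triple (hV : V.IsSemiprime) {I : V.Ideal}
    (h1 : ∀ x ∈ I.pos, ∀ y ∈ I.neg, V.triple x y x = 0)
    (h2 : ∀ y ∈ I.neg, ∀ x ∈ I.pos, V.op.triple y x y = 0) : I.IsZero :=
  hV I (fun x hx y hy => by rw [Q_eq_half_triple, h1 x hx y hy, smul_zero])
    (fun y hy x hx => by rw [Q_eq_half_triple, h2 y hy x hx, smul_zero])

theorem inter_ann_isZero (hV : V.IsSemiprime) (I : V.Ideal) : (I.inter I.ann).IsZero :=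
  isZero_of_triple hV (fun x hx y hy => hx.2.1 y hy.1 x) (fun y hy x hx => hy.2.1 x hx.1 y)

/-- All products with a factor in $I$ and a factor in $J$ lie in $I\cap J$. -/
theorem pos_le_ann_of_inter_isZero {I J : V.Ideal} (h : (I.inter J).IsZero) :
    I.pos ≤ J.ann.pos := by
  have h1 : ∀ x, x ∈ I.pos → x ∈ J.pos → x = 0 := fun x hI hJ => by
    have : x ∈ (I.inter J).pos := ⟨hI, hJ⟩
    rwa [h.1] at this
  have h2 : ∀ x, x ∈ I.neg → x ∈ J.neg → x = 0 := fun x hI hJ => by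
    have : x ∈ (I.inter J).neg := ⟨hI, hJ⟩
    rwa [h.2] at this
  exact fun z hz => ⟨fun b hb v => h1 _ (I.triple_mem_left hz _ _) (J.triple_mem_mid _ hb _),
    fun t a ha => h1 _ (I.triple_mem_left hz _ _) (J.triple_mem_right _ _ ha),
    fun t b hb => h2 _ (I.op.triple_mem_mid _ hz _) (J.op.triple_mem_right _ _ hb)⟩

theorem isZero_of_inter {I J : V.Ideal} (h : (I.inter J).IsZero) (hJ : J.AnnEqZero) :
    I.IsZero :=
  IsZero.of_le (J.annEqZero_iff.1 hJ) (pos_le_ann_of_inter_isZero h)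
    (pos_le_ann_of_inter_isZero (I := I.op) (J := J.op) (IsZero.op h))

theorem total_annEqZero (hV : V.IsSemiprime) : (total V).AnnEqZero := by
  rw [annEqZero_iff]
  exact (inter_ann_isZero hV (total V)).of_le (le_inf le_top le_rfl) (le_inf le_top le_rfl)

/-- With $A=\mathrm{Ann}(I\cap J)$, semiprimeness gives $A\cap I\cap J=0$. Density of $J$ removes
$J$ from this intersection, then density of $I$ removes $I$. -/
theorem AnnEqZero.inter (hV : V.IsSemiprime) {I J : V.Ideal} (hI : I.AnnEqZero)
    (hJ : J.AnnEqZero) : (I.inter J).AnnEqZero := by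
  rw [annEqZero_iff]
  have h := inter_ann_isZero hV (I.inter J)
  refine isZero_of_inter (J := I) (isZero_of_inter (J := J) (h.of_le ?_ ?_) hJ) hI
  · exact fun x hx => ⟨⟨hx.1.2, hx.2⟩, hx.1.1⟩
  · exact fun x hx => ⟨⟨hx.1.2, hx.2⟩, hx.1.1⟩

/-- The span of `{I⁺, I⁻, V⁺}` and `{I⁺, V⁻, I⁺}`. -/
def sqSubmodule (I : V.Ideal) : Submodule Φ P :=
  Submodule.span Φ ({t | ∃ a ∈ I.pos, ∃ b ∈ I.neg, ∃ x, t = V.triple a b x} ∪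
    {t | ∃ a ∈ I.pos, ∃ y, ∃ c ∈ I.pos, t = V.triple a y c})

theorem triple_mem_sq (I : V.Ideal) {a : P} (ha : a ∈ I.pos) {b : M} (hb : b ∈ I.neg) (x : P) :
    V.triple a b x ∈ I.sqSubmodule :=
  Submodule.subset_span (.inl ⟨a, ha, b, hb, x, rfl⟩)

theorem triple_mem_sq' (I : V.Ideal) {a : P} (ha : a ∈ I.pos) (y : M) {c : P} (hc : c ∈ I.pos) :
    V.triple a y c ∈ I.sqSubmodule :=
  Submodule.subset_span (.inr ⟨a, ha, y, c, hc, rfl⟩)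

theorem triple_mem_sqSubmodule_right (I : V.Ideal) (x : P) (y : M) {z : P}
    (hz : z ∈ I.sqSubmodule) : V.triple x y z ∈ I.sqSubmodule := by
  induction hz using Submodule.span_induction with
  | mem d hd =>
    obtain ⟨a, ha, b, hb, v, rfl⟩ | ⟨a, ha, t, c, hc, rfl⟩ := hd
    · rw [triple_triple]
      exact add_mem (sub_mem (I.triple_mem_sq (I.triple_mem_right _ _ ha) hb _)
        (I.triple_mem_sq ha (I.op.triple_mem_right _ _ hb) _)) (I.triple_mem_sq ha hb _)
    · rw [triple_triple]
      exact add_mem (sub_mem (I.triple_mem_sq' (I.triple_mem_right _ _ ha) _ hc)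
        (I.triple_mem_sq' ha _ hc)) (I.triple_mem_sq' ha _ (I.triple_mem_right _ _ hc))
  | zero => rw [triple_zero_right]; exact zero_mem _
  | add s t _ _ hs ht => rw [triple_add_right]; exact add_mem hs ht
  | smul c s _ hs => rw [triple_smul_right]; exact Submodule.smul_mem _ _ hs

/-- Expanding the inner product by `triple_eq_mid` leaves three terms, each with two factors in $I$.
-/
theorem triple_mem_sqSubmodule_mid (I : V.Ideal) (x : P) {k : M}
    (hk : k ∈ I.op.sqSubmodule) (z : P) : V.triple x k z ∈ I.sqSubmodule := by
  have h1 : ∀ {a : P}, a ∈ I.pos → ∀ {b : M}, b ∈ I.neg → ∀ x : P,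
      V.triple x b a ∈ I.sqSubmodule := fun ha _ hb x => by
    rw [V.triple_comm x]; exact I.triple_mem_sq ha hb x
  induction hk using Submodule.span_induction with
  | mem d hd =>
    obtain ⟨b, hb, a, ha, y, rfl⟩ | ⟨b, hb, v, c, hc, rfl⟩ := hd
    · rw [V.op.triple_comm b a y, V.triple_eq_mid a x z y b]
      exact sub_mem (add_mem (I.triple_mem_sq (I.triple_mem_left ha y x) hb z)
        (h1 (I.triple_mem_left ha y z) hb x))
        (I.triple_mem_sq' ha y (I.triple_mem_mid x hb z))
    · rw [V.triple_eq_mid v x z b c]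
      exact sub_mem (add_mem (I.triple_mem_sq (I.triple_mem_mid v hb x) hc z)
        (h1 (I.triple_mem_mid v hb z) hc x)) (h1 (I.triple_mem_mid x hc z) hb v)
  | zero => rw [triple_zero_mid V]; exact zero_mem _
  | add s t _ _ hs ht => rw [V.triple_add_mid x s t]; exact add_mem hs ht
  | smul c s _ hs => rw [V.triple_smul_mid c x s]; exact Submodule.smul_mem _ _ hs

theorem isIdealPos_sqSubmodule (I : V.Ideal) :
    V.IsIdealPos I.sqSubmodule I.op.sqSubmodule :=
  isIdealPos_of_triple (fun x y _ hz => I.triple_mem_sqSubmodule_right x y hz)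
    (fun x _ hk z => I.triple_mem_sqSubmodule_mid x hk z)

/-- The ideal spanned by `{I, I, V}` and `{I, V, I}`. -/
def sq (I : V.Ideal) : V.Ideal where
  pos := I.sqSubmodule
  neg := I.op.sqSubmodule
  isIdeal_pos := I.isIdealPos_sqSubmodule
  isIdeal_neg := I.op.isIdealPos_sqSubmodule

/-- For $A=\mathrm{Ann}(I^2)$, the products $\{x,y,x\}$ inside $A\cap I$ lie in $I^2\cap A=0$. So
$A\cap I=0$ by semiprimeness, and $A=0$ because $I$ is dense. -/
theorem AnnEqZero.sq (hV : V.IsSemiprime) {I : V.Ideal} (hI : I.AnnEqZero) :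
    I.sq.AnnEqZero := by
  rw [annEqZero_iff]
  have h := inter_ann_isZero hV I.sq
  refine isZero_of_inter (J := I) (isZero_of_triple hV ?_ ?_) hI
  · intro x hx y hy
    have : V.triple x y x ∈ (I.sq.inter I.sq.ann).pos :=
      ⟨I.triple_mem_sq hx.2 hy.2 _, I.sq.ann.triple_mem_right _ _ hx.1⟩
    rwa [h.1] at this
  · intro y hy x hx
    have : V.op.triple y x y ∈ (I.sq.inter I.sq.ann).neg :=
      ⟨I.op.triple_mem_sq hy.2 hx.2 _, I.sq.ann.op.triple_mem_right _ _ hy.1⟩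
    rwa [h.2] at this

end Ideal

end Ideals

end JordanPair

/-! ### Jordan pairs inside Lie algebras: the ideals $\tilde I$ and absorbed elements -/

namespace JordanPair

section Envelopes

variable {Φ : Type u} [CommRing Φ] [Invertible (2 : Φ)]
  {P : Type v} {M : Type w} [AddCommGroup P] [Module Φ P] [AddCommGroup M] [Module Φ M]
  {V : JordanPair Φ P M}
  {P' : Type v'} {M' : Type w'} [AddCommGroup P'] [Module Φ P'] [AddCommGroup M'] [Module Φ M']
  {W : JordanPair Φ P' M'}
  {T : Type*} [LieRing T] [LieAlgebra Φ T]

/-- An embedding of a Jordan pair in a Lie algebra that turns the triple products into double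
brackets. -/
structure LieEnv (V : JordanPair Φ P M) (T : Type*) [LieRing T] [LieAlgebra Φ T] where
  /-- the embedding of `V⁺` -/
  e : P →ₗ[Φ] T
  /-- the embedding of `V⁻` -/
  f : M →ₗ[Φ] T
  e_injective : Function.Injective e
  f_injective : Function.Injective f
  lie_e_e : ∀ x z, ⁅e x, e z⁆ = 0
  lie_f_f : ∀ y t, ⁅f y, f t⁆ = 0
  lie_e_f_e : ∀ x y z, ⁅⁅e x, f y⁆, e z⁆ = e (V.triple x y z)
  lie_f_e_f : ∀ y x t, ⁅⁅f y, e x⁆, f t⁆ = f (V.op.triple y x t)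

theorem IsSemiprime.op (hV : V.IsSemiprime) : V.op.IsSemiprime := fun I h1 h2 =>
  (hV I.op h2 h1).symm

theorem δ_zero_left (V : JordanPair Φ P M) (y : M) : V.δ 0 y = 0 := by
  simpa using V.δ_smul_left 0 0 y

theorem δ_zero_right (V : JordanPair Φ P M) (x : P) : V.δ x 0 = 0 := by
  simpa using V.δ_smul_right 0 x 0

theorem δ_fst_apply (V : JordanPair Φ P M) (x z : P) (y : M) :
    (V.δ x y).1 z = V.triple x y z := rfl

theorem δ_snd_apply (V : JordanPair Φ P M) (x : P) (y t : M) :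
    (V.δ x y).2 t = -V.op.triple y x t := rfl

namespace TKK

@[simp] theorem pos_mk (x : P) {γ : Module.End Φ P × Module.End Φ M} (hγ : γ ∈ V.IDer) (y : M) :
    (mk x γ hγ y).pos = x := rfl

@[simp] theorem der_mk (x : P) {γ : Module.End Φ P × Module.End Φ M} (hγ : γ ∈ V.IDer) (y : M) :
    (mk x γ hγ y).der = γ := rfl

@[simp] theorem neg_mk (x : P) {γ : Module.End Φ P × Module.End Φ M} (hγ : γ ∈ V.IDer) (y : M) :
    (mk x γ hγ y).neg = y := rfl

@[simp] theorem pos_ofPos (x : P) : (ofPos V x).pos = x := rfl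

@[simp] theorem der_ofPos (x : P) : (ofPos V x).der = 0 := rfl

@[simp] theorem neg_ofPos (x : P) : (ofPos V x).neg = 0 := rfl

@[simp] theorem pos_ofNeg (y : M) : (ofNeg V y).pos = 0 := rfl

@[simp] theorem der_ofNeg (y : M) : (ofNeg V y).der = 0 := rfl

@[simp] theorem neg_ofNeg (y : M) : (ofNeg V y).neg = y := rfl

/-- The embedding of `V` in `TKK(V)`. -/
def env (V : JordanPair Φ P M) : LieEnv V V.TKK where
  e :=
    { toFun := ofPos V
      map_add' := fun a b => by ext1 <;> simp
      map_smul' := fun a b => by ext1 <;> simp }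
  f :=
    { toFun := ofNeg V
      map_add' := fun a b => by ext1 <;> simp
      map_smul' := fun a b => by ext1 <;> simp }
  e_injective := fun a b h => congrArg TKK.pos h
  f_injective := fun a b h => congrArg TKK.neg h
  lie_e_e x z := by
    ext1 <;> simp [δ_zero_right]
  lie_f_f x z := by
    ext1 <;> simp [δ_zero_left]
  lie_e_f_e x y z := by
    ext1 <;> simp [-lie_lie, δ_zero_right, δ_fst_apply]
  lie_f_e_f x y z := by
    ext1 <;> simp [-lie_lie, δ_zero_right, δ_zero_left, δ_snd_apply]

end TKK

namespace LieEnv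

/-- The same embedding, of the opposite pair. -/
def op (E : LieEnv V T) : LieEnv V.op T where
  e := E.f
  f := E.e
  e_injective := E.f_injective
  f_injective := E.e_injective
  lie_e_e := E.lie_f_f
  lie_f_f := E.lie_e_e
  lie_e_f_e := E.lie_f_e_f
  lie_f_e_f := E.lie_e_f_e

variable (E : LieEnv V T)

/-- The span of `I⁺`, `I⁻`, `[I⁺, V⁻]` and `[V⁺, I⁻]`. -/
def tilde (I : V.Ideal) : Submodule Φ T :=
  Submodule.span Φ {t | (∃ a ∈ I.pos, t = E.e a) ∨ (∃ b ∈ I.neg, t = E.f b) ∨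
    (∃ a ∈ I.pos, ∃ y, t = ⁅E.e a, E.f y⁆) ∨ (∃ x, ∃ b ∈ I.neg, t = ⁅E.e x, E.f b⁆)}

variable {E} {I : V.Ideal}

theorem e_mem {a : P} (ha : a ∈ I.pos) : E.e a ∈ E.tilde I :=
  Submodule.subset_span (.inl ⟨a, ha, rfl⟩)

theorem f_mem {b : M} (hb : b ∈ I.neg) : E.f b ∈ E.tilde I :=
  Submodule.subset_span (.inr (.inl ⟨b, hb, rfl⟩))

theorem lie_mem_left {a : P} (ha : a ∈ I.pos) (y : M) : ⁅E.e a, E.f y⁆ ∈ E.tilde I :=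
  Submodule.subset_span (.inr (.inr (.inl ⟨a, ha, y, rfl⟩)))

theorem lie_mem_right (x : P) {b : M} (hb : b ∈ I.neg) : ⁅E.e x, E.f b⁆ ∈ E.tilde I :=
  Submodule.subset_span (.inr (.inr (.inr ⟨x, b, hb, rfl⟩)))

theorem tilde_le {S : Submodule Φ T} (h1 : ∀ a ∈ I.pos, E.e a ∈ S) (h2 : ∀ b ∈ I.neg, E.f b ∈ S)
    (h3 : ∀ a ∈ I.pos, ∀ y, ⁅E.e a, E.f y⁆ ∈ S) (h4 : ∀ x, ∀ b ∈ I.neg, ⁅E.e x, E.f b⁆ ∈ S) :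
    E.tilde I ≤ S := by
  refine Submodule.span_le.2 ?_
  rintro t (⟨a, ha, rfl⟩ | ⟨b, hb, rfl⟩ | ⟨a, ha, y, rfl⟩ | ⟨x, b, hb, rfl⟩)
  exacts [h1 a ha, h2 b hb, h3 a ha y, h4 x b hb]

omit [Invertible (2 : Φ)] in
theorem lie_mem_comm {S : Submodule Φ T} {s t : T} : ⁅s, t⁆ ∈ S ↔ ⁅t, s⁆ ∈ S := by
  rw [← lie_skew, neg_mem_iff]

theorem tilde_op_le : E.op.tilde I.op ≤ E.tilde I :=
  tilde_le (fun _ hb => f_mem hb) (fun _ ha => e_mem ha)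
    (fun _ hb y => lie_mem_comm.1 (lie_mem_right y hb))
    (fun x _ ha => lie_mem_comm.1 (lie_mem_left ha x))

theorem tilde_op : E.op.tilde I.op = E.tilde I :=
  le_antisymm tilde_op_le (tilde_op_le (E := E.op) (I := I.op))

theorem tilde_mono {I J : V.Ideal} (h1 : I.pos ≤ J.pos) (h2 : I.neg ≤ J.neg) :
    E.tilde I ≤ E.tilde J :=
  tilde_le (fun _ h => e_mem (h1 h)) (fun _ h => f_mem (h2 h)) (fun _ h y => lie_mem_left (h1 h) y)
    (fun x _ h => lie_mem_right x (h2 h))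

theorem e_lie_mem (x : P) {u : T} (hu : u ∈ E.tilde I) : ⁅E.e x, u⁆ ∈ E.tilde I := by
  suffices h : E.tilde I ≤ (E.tilde I).comap (LieAlgebra.ad Φ T (E.e x)) from h hu
  refine tilde_le (fun a ha => ?_) (fun b hb => lie_mem_right x hb) (fun a ha y => ?_)
    (fun z b hb => ?_)
  · simp [E.lie_e_e]
  · refine (lie_mem_comm (S := E.tilde I)).2 ?_
    rw [E.lie_e_f_e]; exact e_mem (I.triple_mem_left ha _ _)
  · refine (lie_mem_comm (S := E.tilde I)).2 ?_
    rw [E.lie_e_f_e]; exact e_mem (I.triple_mem_mid _ hb _)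

theorem f_lie_mem (y : M) {u : T} (hu : u ∈ E.tilde I) : ⁅E.f y, u⁆ ∈ E.tilde I := by
  rw [← tilde_op] at hu ⊢; exact e_lie_mem (E := E.op) y hu

variable (E) in
/-- The subalgebra generated by `V`, as a submodule. -/
def sub : Submodule Φ T := E.tilde (Ideal.total V)

theorem e_mem_sub (x : P) : E.e x ∈ E.sub := e_mem (Submodule.mem_top : x ∈ (⊤ : Submodule Φ P))

theorem f_mem_sub (y : M) : E.f y ∈ E.sub := f_mem (Submodule.mem_top : y ∈ (⊤ : Submodule Φ M))

theorem lie_mem_sub (x : P) (y : M) : ⁅E.e x, E.f y⁆ ∈ E.sub :=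
  lie_mem_left (Submodule.mem_top : x ∈ (⊤ : Submodule Φ P)) y

theorem sub_le {S : Submodule Φ T} (h1 : ∀ a, E.e a ∈ S) (h2 : ∀ b, E.f b ∈ S)
    (h3 : ∀ a y, ⁅E.e a, E.f y⁆ ∈ S) : E.sub ≤ S :=
  tilde_le (fun a _ => h1 a) (fun b _ => h2 b) (fun a _ y => h3 a y) (fun a y _ => h3 a y)

theorem tilde_le_sub : E.tilde I ≤ E.sub := tilde_mono le_top le_top

/-- A submodule that is stable under the brackets with `V` is stable under the brackets with the
subalgebra generated by `V`. -/
theorem lie_mem_of_stable {S : Submodule Φ T} (h1 : ∀ x, ∀ u ∈ S, ⁅E.e x, u⁆ ∈ S)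
    (h2 : ∀ y, ∀ u ∈ S, ⁅E.f y, u⁆ ∈ S) {l u : T} (hl : l ∈ E.sub) (hu : u ∈ S) :
    ⁅l, u⁆ ∈ S := by
  suffices h : E.sub ≤ ⨅ u ∈ S, S.comap (LieAlgebra.ad Φ T u) by
    have := h hl
    simp only [Submodule.mem_iInf] at this
    exact lie_mem_comm.2 (this u hu)
  refine sub_le (fun x => ?_) (fun y => ?_) (fun x y => ?_)
  · simp only [Submodule.mem_iInf]
    exact fun u hu => lie_mem_comm.2 (h1 x u hu)
  · simp only [Submodule.mem_iInf]
    exact fun u hu => lie_mem_comm.2 (h2 y u hu)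
  · simp only [Submodule.mem_iInf]
    intro u hu
    refine (lie_mem_comm (S := S)).2 ?_
    rw [lie_lie]
    exact sub_mem (h1 _ _ (h2 _ _ hu)) (h2 _ _ (h1 _ _ hu))

theorem lie_mem_tilde {l u : T} (hl : l ∈ E.sub) (hu : u ∈ E.tilde I) : ⁅l, u⁆ ∈ E.tilde I :=
  lie_mem_of_stable (fun x _ h => e_lie_mem x h) (fun y _ h => f_lie_mem y h) hl hu

theorem lie_mem_tilde' {l u : T} (hl : l ∈ E.sub) (hu : u ∈ E.tilde I) : ⁅u, l⁆ ∈ E.tilde I :=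
  lie_mem_comm.2 (lie_mem_tilde hl hu)

/-- The generators of $I^2$ are double brackets: $\{x,b,a\}=[[x,b],a]$ and $\{a,y,c\}=[[a,y],c]$,
with inner bracket and outer factor both in $\tilde I$. -/
theorem e_mem_lie {a : P} (ha : a ∈ I.sq.pos) {S : Submodule Φ T}
    (hS : ∀ u ∈ E.tilde I, ∀ v ∈ E.tilde I, ⁅u, v⁆ ∈ S) : E.e a ∈ S := by
  suffices h : I.sq.pos ≤ S.comap E.e from h ha
  refine Submodule.span_le.2 ?_
  rintro t (⟨a, ha, b, hb, x, rfl⟩ | ⟨a, ha, y, c, hc, rfl⟩)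
  · change E.e _ ∈ S
    rw [triple_comm, ← E.lie_e_f_e]
    exact hS _ (lie_mem_right x hb) _ (e_mem ha)
  · change E.e _ ∈ S
    rw [← E.lie_e_f_e]
    exact hS _ (lie_mem_left ha y) _ (e_mem hc)

theorem f_mem_lie {a : M} (ha : a ∈ I.sq.neg) {S : Submodule Φ T}
    (hS : ∀ u ∈ E.tilde I, ∀ v ∈ E.tilde I, ⁅u, v⁆ ∈ S) : E.f a ∈ S :=
  e_mem_lie (E := E.op) (I := I.op) ha (by rwa [tilde_op])

/-- The span of $[\tilde I,\tilde I]$ contains $(I^2)^\pm$ and is stable under $L$ by the Leibniz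
rule, so it also contains the brackets of $(I^2)^\pm$ with $V^\mp$. -/
theorem tilde_sq_le {S : Submodule Φ T} (hS : ∀ u ∈ E.tilde I, ∀ v ∈ E.tilde I, ⁅u, v⁆ ∈ S) :
    E.tilde I.sq ≤ S := by
  suffices h : E.tilde I.sq ≤ Submodule.span Φ {t | ∃ u ∈ E.tilde I, ∃ v ∈ E.tilde I, t = ⁅u, v⁆}
      from h.trans (Submodule.span_le.2 (by rintro t ⟨u, hu, v, hv, rfl⟩; exact hS u hu v hv))
  set D := Submodule.span Φ {t | ∃ u ∈ E.tilde I, ∃ v ∈ E.tilde I, t = ⁅u, v⁆} with hD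
  have hmem : ∀ u ∈ E.tilde I, ∀ v ∈ E.tilde I, ⁅u, v⁆ ∈ D := fun u hu v hv =>
    Submodule.subset_span ⟨u, hu, v, hv, rfl⟩
  have stab : ∀ l ∈ E.sub, ∀ d ∈ D, ⁅l, d⁆ ∈ D := by
    intro l hl d hd
    suffices h : D ≤ D.comap (LieAlgebra.ad Φ T l) from h hd
    refine Submodule.span_le.2 ?_
    rintro t ⟨u, hu, v, hv, rfl⟩
    change ⁅l, ⁅u, v⁆⁆ ∈ D
    rw [leibniz_lie]
    exact add_mem (hmem _ (lie_mem_tilde hl hu) _ hv) (hmem _ hu _ (lie_mem_tilde hl hv))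
  have he := fun a (ha : a ∈ I.sq.pos) => e_mem_lie ha hmem
  have hf := fun a (ha : a ∈ I.sq.neg) => f_mem_lie ha hmem
  exact tilde_le he hf (fun a ha y => lie_mem_comm.2 (stab _ (f_mem_sub y) _ (he a ha)))
    (fun x b hb => stab _ (e_mem_sub x) _ (hf b hb))

/-- By $[[u,v],t]=[u,[v,t]]-[v,[u,t]]$, passing to the square of an ideal permits testing on two
successive brackets with $\tilde I$. -/
theorem sq_lie_mem {S : Submodule Φ T} {t : T}
    (h : ∀ u ∈ E.tilde I, ∀ v ∈ E.tilde I, ⁅u, ⁅v, t⁆⁆ ∈ S) {k : T} (hk : k ∈ E.tilde I.sq) :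
    ⁅k, t⁆ ∈ S := by
  suffices h : E.tilde I.sq ≤ S.comap (LieAlgebra.ad Φ T t) from lie_mem_comm.2 (h hk)
  refine tilde_sq_le (fun u hu v hv => (lie_mem_comm (S := S)).2 ?_)
  rw [lie_lie]
  exact sub_mem (h u hu v hv) (h v hv u hu)

variable (E) in
/-- The elements `t` with `[I, t] ⊆ L` for an ideal `I` of `V` with zero annihilator, where `L` is
the subalgebra generated by `V`. -/
def Absorbed (t : T) : Prop := ∃ K : V.Ideal, K.AnnEqZero ∧ ∀ k ∈ E.tilde K, ⁅k, t⁆ ∈ E.sub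

theorem Absorbed.of_op {t : T} (h : E.op.Absorbed t) : E.Absorbed t := by
  obtain ⟨K, hK, h⟩ := h
  refine ⟨K.op, ⟨hK.2, hK.1⟩, fun k hk => ?_⟩
  rw [sub, ← tilde_op]
  exact h k (tilde_op_le (E := E.op) (I := K) hk)

theorem absorbed_of_mem_sub (hV : V.IsSemiprime) {t : T} (ht : t ∈ E.sub) : E.Absorbed t :=
  ⟨_, Ideal.total_annEqZero hV, fun _ hk => lie_mem_tilde hk ht⟩

theorem Absorbed.common (hV : V.IsSemiprime) {s t : T} (hs : E.Absorbed s) (ht : E.Absorbed t) :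
    ∃ K : V.Ideal, K.AnnEqZero ∧ (∀ k ∈ E.tilde K, ⁅k, s⁆ ∈ E.sub) ∧
      ∀ k ∈ E.tilde K, ⁅k, t⁆ ∈ E.sub := by
  obtain ⟨K, hK, h⟩ := hs
  obtain ⟨K', hK', h'⟩ := ht
  exact ⟨K.inter K', hK.inter hV hK', fun k hk => h k (tilde_mono inf_le_left inf_le_left hk),
    fun k hk => h' k (tilde_mono inf_le_right inf_le_right hk)⟩

theorem Absorbed.add (hV : V.IsSemiprime) {s t : T} (hs : E.Absorbed s) (ht : E.Absorbed t) :
    E.Absorbed (s + t) := by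
  obtain ⟨K, hK, h1, h2⟩ := hs.common hV ht
  exact ⟨K, hK, fun k hk => by rw [lie_add]; exact add_mem (h1 k hk) (h2 k hk)⟩

theorem Absorbed.smul {t : T} (ht : E.Absorbed t) (c : Φ) : E.Absorbed (c • t) := by
  obtain ⟨K, hK, h1⟩ := ht
  exact ⟨K, hK, fun k hk => by rw [lie_smul]; exact Submodule.smul_mem _ _ (h1 k hk)⟩

theorem sq_lie_mem_tilde {K : V.Ideal} {t : T} (h : ∀ k ∈ E.tilde K, ⁅k, t⁆ ∈ E.sub) {k : T}
    (hk : k ∈ E.tilde K.sq) : ⁅k, t⁆ ∈ E.tilde K :=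
  sq_lie_mem (fun _ hu v hv => lie_mem_tilde' (h v hv) hu) hk

/-- If $\tilde K$ sends $s$ and $t$ into $L$, then $\widetilde{K^2}$ sends them into $\tilde K$;
both terms of $[k,[s,t]]=[[k,s],t]+[s,[k,t]]$ then lie in $L$. -/
theorem Absorbed.lie (hV : V.IsSemiprime) {s t : T} (hs : E.Absorbed s) (ht : E.Absorbed t) :
    E.Absorbed ⁅s, t⁆ := by
  obtain ⟨K, hK, h1, h2⟩ := hs.common hV ht
  refine ⟨K.sq, hK.sq hV, fun k hk => ?_⟩
  rw [leibniz_lie]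
  refine add_mem (h2 _ (sq_lie_mem_tilde h1 hk)) (lie_mem_comm.2 (h1 _ (sq_lie_mem_tilde h2 hk)))

/-- Because $\tilde K$ is an ideal of $L$, its centralizer in $T$ is stable under $L$. -/
theorem lie_eq_zero_of_lie {K : V.Ideal} {l t : T} (hl : l ∈ E.sub)
    (h : ∀ u ∈ E.tilde K, ⁅u, t⁆ = 0) : ∀ u ∈ E.tilde K, ⁅u, ⁅l, t⁆⁆ = 0 := by
  intro u hu
  rw [leibniz_lie, h _ (lie_mem_tilde' hl hu), h u hu, lie_zero, add_zero]

theorem mem_annPos_of_lie_eq_zero {K : V.Ideal} {v : P}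
    (h : ∀ u ∈ E.tilde K, ⁅u, E.e v⁆ = 0) : v ∈ V.annPos K.pos K.neg := by
  have h' : ∀ u ∈ E.tilde K, ⁅E.e v, u⁆ = 0 := fun u hu => by
    rw [← lie_skew, h u hu, _root_.neg_zero]
  refine ⟨fun b hb x => E.e_injective ?_, fun t a ha => E.e_injective ?_,
    fun t b hb => E.f_injective ?_⟩
  · rw [← E.lie_e_f_e, h' _ (f_mem hb), zero_lie, map_zero]
  · rw [triple_comm, ← E.lie_e_f_e, h _ (lie_mem_left ha t), map_zero]
  · rw [triple_comm, ← E.lie_f_e_f, h _ (f_mem hb), zero_lie, map_zero]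

end LieEnv

theorem Inclusion.map_triple (i : Inclusion V W) (x : P) (y : M) (z : P) :
    i.pos (V.triple x y z) = W.triple (i.pos x) (i.neg y) (i.pos z) := by
  simp [triple, quadTriple, QuadraticMap.polar, i.map_Q]

/-! ### Subpairs: absorption of $W^\pm$ and faithfulness of dense ideals on $W^\pm$ -/

namespace LieEnv

/-- The embedding of a subpair. -/
def restrict (F : LieEnv W T) (i : Inclusion V W) : LieEnv V T where
  e := F.e ∘ₗ i.pos
  f := F.f ∘ₗ i.neg
  e_injective := F.e_injective.comp i.pos_injective
  f_injective := F.f_injective.comp i.neg_injective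
  lie_e_e _ _ := F.lie_e_e _ _
  lie_f_f _ _ := F.lie_f_f _ _
  lie_e_f_e x y z := by
    simp only [LinearMap.comp_apply, F.lie_e_f_e, i.map_triple]
  lie_f_e_f x y z := by
    simp only [LinearMap.comp_apply, F.lie_f_e_f]
    exact congrArg F.f (i.op.map_triple x y z).symm

variable {F : LieEnv W T} {i : Inclusion V W}

theorem restrict_e (x : P) : (F.restrict i).e x = F.e (i.pos x) := rfl

theorem restrict_f (y : M) : (F.restrict i).f y = F.f (i.neg y) := rfl

theorem absorbed_e (hV : V.IsSemiprime) (h : i.AbsorbsPos) (q : P') :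
    (F.restrict i).Absorbed (F.e q) := by
  by_cases hq : q = 0
  · rw [hq, map_zero]; exact absorbed_of_mem_sub hV (zero_mem _)
  obtain ⟨J, hJ, h1, h2, h3, -⟩ := h q hq
  -- $J$ itself need not suffice: for $b\in J^-$ the bracket $[q,b]$ is a derivation preserving $V$,
  -- but possibly not in $L$. A second bracket with $\tilde J$ brings it back into $L$.
  refine ⟨J.sq, hJ.sq hV, fun k hk => sq_lie_mem (fun u hu v hv => ?_) hk⟩
  have hpos : ∀ s ∈ i.pos.range, ⁅F.e s, u⁆ ∈ (F.restrict i).sub := by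
    rintro _ ⟨s, rfl⟩
    exact tilde_le_sub (e_lie_mem  s hu)
  suffices h : (F.restrict i).tilde J ≤
      (F.restrict i).sub.comap (LieAlgebra.ad Φ T u ∘ₗ LieAlgebra.ad Φ T (F.e q)) by
    have := h hv
    rw [← lie_skew v, lie_neg, neg_mem_iff]
    exact this
  refine tilde_le (fun a ha => ?_) (fun b hb => ?_) (fun a ha y => ?_) (fun x b hb => ?_)
  · change ⁅u, ⁅F.e q, F.e _⁆⁆ ∈ (F.restrict i).sub
    simp [F.lie_e_e]
  · change ⁅u, ⁅F.e q, F.f (i.neg b)⁆⁆ ∈ (F.restrict i).sub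
    refine (lie_mem_comm (S := (F.restrict i).sub)).2 ?_
    -- The derivation $[q,b]$ maps $V^\pm$ into $V^\pm$, hence, by the Leibniz rule, $L$ into $L$.
    suffices h : (F.restrict i).sub ≤
        (F.restrict i).sub.comap (LieAlgebra.ad Φ T ⁅F.e q, F.f (i.neg b)⁆) from
      h (tilde_le_sub hu)
    have he : ∀ x, ⁅⁅F.e q, F.f (i.neg b)⁆, (F.restrict i).e x⁆ ∈ (F.restrict i).sub := fun x => by
      rw [restrict_e, F.lie_e_f_e]
      obtain ⟨s, hs⟩ := h1 b hb x
      rw [← hs]; exact e_mem_sub  s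
    have hf : ∀ y, ⁅⁅F.e q, F.f (i.neg b)⁆, (F.restrict i).f y⁆ ∈ (F.restrict i).sub := fun y => by
      rw [restrict_f, ← lie_skew (F.e q), neg_lie, F.lie_f_e_f]
      obtain ⟨s, hs⟩ := h3 b hb y
      rw [← hs]; exact neg_mem (f_mem_sub  s)
    refine sub_le he hf (fun x y => ?_)
    change ⁅_, _⁆ ∈ (F.restrict i).sub
    rw [leibniz_lie]
    exact add_mem (lie_mem_tilde (he x) (f_mem_sub y)) (lie_mem_tilde (e_mem_sub x) (hf y))
  · change ⁅u, ⁅F.e q, ⁅F.e (i.pos a), F.f (i.neg y)⁆⁆⁆ ∈ (F.restrict i).sub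
    refine (lie_mem_comm (S := (F.restrict i).sub)).2 ?_
    rw [← lie_skew (F.e q), F.lie_e_f_e, neg_lie, neg_mem_iff, triple_comm]
    exact hpos _ (h2 y a ha)
  · change ⁅u, ⁅F.e q, ⁅F.e (i.pos x), F.f (i.neg b)⁆⁆⁆ ∈ (F.restrict i).sub
    refine (lie_mem_comm (S := (F.restrict i).sub)).2 ?_
    rw [← lie_skew (F.e q), F.lie_e_f_e, neg_lie, neg_mem_iff, triple_comm]
    exact hpos _ (h1 b hb x)

theorem absorbed_f (hV : V.IsSemiprime) (h : i.op.AbsorbsPos) (q : M') :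
    (F.restrict i).Absorbed (F.f q) :=
  Absorbed.of_op (absorbed_e (F := F.op) (i := i.op) hV.op h q)

/-- If $z\ne0$, some product of $z$ with elements of $V$ is nonzero and lies in $V$. It is obtained
from $z$ by brackets with $L$, so $\tilde K$ kills it too and it lies in $\mathrm{Ann}_V(K)=0$. -/
theorem eq_zero_of_lie_e (h : i.AbsorbsPos) {K : V.Ideal} (hK : K.AnnEqZero) {z : P'}
    (hz : ∀ u ∈ (F.restrict i).tilde K, ⁅u, F.e z⁆ = 0) : z = 0 := by
  by_contra hz0
  obtain ⟨J, -, h1, h2, h3, h4⟩ := h z hz0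
  have hpos : ∀ v, (∀ u ∈ (F.restrict i).tilde K, ⁅u, (F.restrict i).e v⁆ = 0) → v = 0 := by
    intro v hv
    have := mem_annPos_of_lie_eq_zero hv
    rwa [hK.1] at this
  have hneg : ∀ v, (∀ u ∈ (F.restrict i).tilde K, ⁅u, (F.restrict i).f v⁆ = 0) → v = 0 := by
    intro v hv
    have := mem_annPos_of_lie_eq_zero (E := (F.restrict i).op) (K := K.op) (v := v)
      (by rwa [tilde_op])
    have h2 := hK.2
    change v ∈ V.op.annPos K.neg K.pos at this
    rwa [h2] at this
  have key : ∀ x y, W.triple z (i.neg y) (i.pos x) ∈ i.pos.range →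
      W.triple z (i.neg y) (i.pos x) = 0 := by
    rintro x y ⟨s, hs⟩
    rw [← hs, hpos s, map_zero]
    rw [restrict_e, hs, triple_comm, ← F.lie_e_f_e]
    exact lie_eq_zero_of_lie (lie_mem_sub x y) hz
  obtain ⟨b, hb, x, h⟩ | ⟨y, a, ha, h⟩ | ⟨b, hb, y, h⟩ := h4
  · exact h (key x b (h1 b hb x))
  · exact h (key a y (h2 y a ha))
  · obtain ⟨s, hs⟩ := h3 b hb y
    refine h ?_
    rw [← hs, hneg s, map_zero]
    rw [restrict_f, hs, ← F.lie_f_e_f, ← lie_skew]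
    intro u hu
    change ⁅u, -⁅(F.restrict i).f y, ⁅(F.restrict i).f b, F.e z⁆⁆⁆ = 0
    rw [lie_neg, lie_eq_zero_of_lie (f_mem_sub y) (lie_eq_zero_of_lie (f_mem_sub b) hz) u hu,
      _root_.neg_zero]

theorem eq_zero_of_lie_f (h : i.op.AbsorbsPos) {K : V.Ideal} (hK : K.AnnEqZero) {z : M'}
    (hz : ∀ u ∈ (F.restrict i).tilde K, ⁅u, F.f z⁆ = 0) : z = 0 := by
  rw [← tilde_op] at hz
  exact eq_zero_of_lie_e (F := F.op) (K := K.op) h ⟨hK.2, hK.1⟩ hz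

end LieEnv

end Envelopes

end JordanPair

/-! ### The $L$-submodule generated by an element -/

section AdSpan

variable {Φ Q : Type*} [CommRing Φ] [LieRing Q] [LieAlgebra Φ Q] {L : LieSubalgebra Φ Q} {q : Q}

theorem LieSubalgebra.self_mem_adSpan : q ∈ L.adSpan q := Submodule.subset_span ⟨[], rfl⟩

theorem LieSubalgebra.lie_mem_adSpan {x m : Q} (hx : x ∈ L) (hm : m ∈ L.adSpan q) :
    ⁅x, m⁆ ∈ L.adSpan q := by
  suffices h : L.adSpan q ≤ (L.adSpan q).comap (LieAlgebra.ad Φ Q x) from h hm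
  refine Submodule.span_le.2 ?_
  rintro _ ⟨l, rfl⟩
  exact Submodule.subset_span ⟨⟨x, hx⟩ :: l, rfl⟩

theorem LieSubalgebra.adSpan_le {S : Submodule Φ Q} (hq : q ∈ S)
    (h : ∀ x ∈ L, ∀ m ∈ S, ⁅x, m⁆ ∈ S) : L.adSpan q ≤ S := by
  refine Submodule.span_le.2 ?_
  rintro _ ⟨l, rfl⟩
  induction l with
  | nil => exact hq
  | cons x l ih => exact h x x.2 _ ih

end AdSpan

/-! ### From $\mathfrak M$-quotients to algebras of quotients -/

namespace JordanPair

section Forward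

variable {Φ : Type u} [CommRing Φ] [Invertible (2 : Φ)]
  {P : Type v} {M : Type w} [AddCommGroup P] [Module Φ P] [AddCommGroup M] [Module Φ M]
  {V : JordanPair Φ P M}
  {P' : Type v'} {M' : Type w'} [AddCommGroup P'] [Module Φ P'] [AddCommGroup M'] [Module Φ M']
  {W : JordanPair Φ P' M'} {i : Inclusion V W}

namespace TKK

/-- The inclusion of `IDer V` in `TKK(V)`. -/
def ofDer (γ : Module.End Φ P × Module.End Φ M) (hγ : γ ∈ V.IDer) : V.TKK := mk 0 γ hγ 0

theorem lie_ofPos_ofNeg (x : P) (y : M) :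
    ⁅ofPos V x, ofNeg V y⁆ = ofDer (V.δ x y) (V.δ_mem x y) := by
  ext1 <;> simp [ofDer, δ_zero_right]

theorem eq_add (t : V.TKK) : t = (env V).e t.pos + ofDer t.der t.der_mem + (env V).f t.neg := by
  change t = ofPos V t.pos + _ + ofNeg V t.neg
  ext1 <;> simp [ofDer]

theorem ofDer_add {γ μ : Module.End Φ P × Module.End Φ M} (hγ : γ ∈ V.IDer) (hμ : μ ∈ V.IDer) :
    ofDer (γ + μ) (add_mem hγ hμ) = ofDer γ hγ + ofDer μ hμ := by
  ext1 <;> simp [ofDer]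

theorem ofDer_smul (a : Φ) {γ : Module.End Φ P × Module.End Φ M} (hγ : γ ∈ V.IDer) :
    ofDer (a • γ) (Submodule.smul_mem _ a hγ) = a • ofDer γ hγ := by
  ext1 <;> simp [ofDer]

theorem ofDer_mem_sub {γ : Module.End Φ P × Module.End Φ M} (hγ : γ ∈ V.IDer) :
    ofDer γ hγ ∈ (env V).sub := by
  refine Submodule.span_induction (p := fun γ (hγ : γ ∈ V.IDer) => ofDer γ hγ ∈ (env V).sub)
    ?_ (zero_mem _) (fun γ μ hγ hμ h h' => ?_) (fun a γ hγ h => ?_) hγ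
  · rintro _ ⟨x, y, rfl⟩
    rw [← lie_ofPos_ofNeg]
    exact LieEnv.lie_mem_sub (E := env V) x y
  · exact (congrArg (· ∈ (env V).sub) (ofDer_add hγ hμ)).mpr (add_mem h h')
  · exact (congrArg (· ∈ (env V).sub) (ofDer_smul a hγ)).mpr (Submodule.smul_mem _ a h)

theorem sub_env (V : JordanPair Φ P M) : (env V).sub = ⊤ := by
  refine eq_top_iff.2 fun t _ => ?_
  rw [eq_add t]
  exact add_mem (add_mem (LieEnv.e_mem_sub _) (ofDer_mem_sub _)) (LieEnv.f_mem_sub _)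

end TKK

open TKK

theorem absorbed_of_isPairOfMQuotients (hV : V.IsSemiprime) (h : IsPairOfMQuotients i)
    (t : W.TKK) : ((env W).restrict i).Absorbed t := by
  let E := (env W).restrict i
  let S : Submodule Φ W.TKK :=
    { carrier := {t | E.Absorbed t}
      add_mem' := fun hs ht => hs.add hV ht
      zero_mem' := LieEnv.absorbed_of_mem_sub hV (zero_mem _)
      smul_mem' := fun c _ ht => ht.smul c }
  have hS : (env W).sub ≤ S := LieEnv.sub_le (LieEnv.absorbed_e hV h.1)
    (LieEnv.absorbed_f hV h.2)
    (fun x y => (LieEnv.absorbed_e hV h.1 x).lie hV (LieEnv.absorbed_f hV h.2 y))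
  rw [sub_env] at hS
  exact hS (Submodule.mem_top : t ∈ (⊤ : Submodule Φ W.TKK))

/-- $\tilde K$ is spanned by homogeneous elements, so the bracket with $p$ can be read off degree by
degree. -/
theorem lie_components_eq_zero {K : V.Ideal} {p : W.TKK}
    (hp : ∀ u ∈ ((env W).restrict i).tilde K, ⁅u, p⁆ = 0) :
    (∀ u ∈ ((env W).restrict i).tilde K, ⁅u, (env W).e p.pos⁆ = 0) ∧
      ∀ u ∈ ((env W).restrict i).tilde K, ⁅u, (env W).f p.neg⁆ = 0 := by
  set E := (env W).restrict i
  have he : ∀ a, ⁅ofPos W a, p⁆ = 0 → W.δ a p.neg = 0 := fun a h => by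
    simpa [δ_zero_right, δ_zero_left] using congrArg TKK.der h
  have hf : ∀ b, ⁅ofNeg W b, p⁆ = 0 → W.δ p.pos b = 0 := fun b h => by
    simpa [δ_zero_right, δ_zero_left] using congrArg TKK.der h
  have hd : ∀ a b, ⁅⁅ofPos W a, ofNeg W b⁆, p⁆ = 0 →
      (W.δ a b).1 p.pos = 0 ∧ (W.δ a b).2 p.neg = 0 := fun a b h => by
    rw [lie_ofPos_ofNeg] at h
    exact ⟨by simpa [ofDer] using congrArg TKK.pos h, by simpa [ofDer] using congrArg TKK.neg h⟩
  have ed : ∀ a b, (W.δ a b).1 p.pos = 0 → ⁅⁅ofPos W a, ofNeg W b⁆, ofPos W p.pos⁆ = 0 :=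
    fun a b h => by
      rw [lie_ofPos_ofNeg]; ext1 <;> simp [ofDer, δ_zero_right, h]
  have fd : ∀ a b, (W.δ a b).2 p.neg = 0 → ⁅⁅ofPos W a, ofNeg W b⁆, ofNeg W p.neg⁆ = 0 :=
    fun a b h => by
      rw [lie_ofPos_ofNeg]; ext1 <;> simp [ofDer, δ_zero_right, δ_zero_left, h]
  have hker : ∀ s : W.TKK, (∀ a ∈ K.pos, ⁅s, E.e a⁆ = 0) → (∀ b ∈ K.neg, ⁅s, E.f b⁆ = 0) →
      (∀ a ∈ K.pos, ∀ y, ⁅s, ⁅E.e a, E.f y⁆⁆ = 0) →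
      (∀ x, ∀ b ∈ K.neg, ⁅s, ⁅E.e x, E.f b⁆⁆ = 0) → ∀ u ∈ E.tilde K, ⁅u, s⁆ = 0 := by
    intro s h1 h2 h3 h4 u hu
    have hle : E.tilde K ≤ (⊥ : Submodule Φ W.TKK).comap (LieAlgebra.ad Φ W.TKK s) :=
      LieEnv.tilde_le h1 h2 h3 h4
    rw [← lie_skew, show ⁅s, u⁆ = 0 from hle hu, _root_.neg_zero]
  have skew : ∀ s t : W.TKK, ⁅t, s⁆ = 0 → ⁅s, t⁆ = 0 := fun s t h => by
    rw [← lie_skew, h, _root_.neg_zero]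
  constructor
  · refine hker _ (fun a ha => (env W).lie_e_e _ _) (fun b hb => ?_)
      (fun a ha y => skew _ _ (ed _ _ (hd _ _ (hp _ (LieEnv.lie_mem_left ha y))).1))
      (fun x b hb => skew _ _ (ed _ _ (hd _ _ (hp _ (LieEnv.lie_mem_right x hb))).1))
    change ⁅ofPos W p.pos, ofNeg W (i.neg b)⁆ = 0
    ext1 <;> simp [hf _ (hp _ (LieEnv.f_mem hb)), δ_zero_right]
  · refine hker _ (fun a ha => skew _ _ ?_) (fun b hb => (env W).lie_f_f _ _)
      (fun a ha y => skew _ _ (fd _ _ (hd _ _ (hp _ (LieEnv.lie_mem_left ha y))).2))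
      (fun x b hb => skew _ _ (fd _ _ (hd _ _ (hp _ (LieEnv.lie_mem_right x hb))).2))
    change ⁅ofPos W (i.pos a), ofNeg W p.neg⁆ = 0
    ext1 <;> simp [he _ (hp _ (LieEnv.e_mem ha)), δ_zero_right]

/-- The outer components vanish by faithfulness on $W^\pm$. What remains of $p$ is a derivation, and
its values $[p,w]$ on $W^\pm$ are killed by a smaller dense ideal, hence vanish. -/
theorem eq_zero_of_lie_eq_zero (hV : V.IsSemiprime) (h : IsPairOfMQuotients i) {K : V.Ideal}
    (hK : K.AnnEqZero) {p : W.TKK} (hp : ∀ u ∈ ((env W).restrict i).tilde K, ⁅u, p⁆ = 0) :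
    p = 0 := by
  obtain ⟨h1, h2⟩ := lie_components_eq_zero hp
  have hpos := LieEnv.eq_zero_of_lie_e h.1 hK h1
  have hneg := LieEnv.eq_zero_of_lie_f h.2 hK h2
  have key : ∀ w : W.TKK, ∃ J : V.Ideal, J.AnnEqZero ∧
      ∀ u ∈ ((env W).restrict i).tilde J, ⁅u, ⁅p, w⁆⁆ = 0 := fun w => by
    obtain ⟨J, hJ, hw⟩ := absorbed_of_isPairOfMQuotients hV h w
    -- For $u$ in the tilde of this square, $[u,w]$ still lies in $\tilde K$, so both $[[u,p],w]$
    -- and $[p,[u,w]]$ vanish.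
    refine ⟨(K.inter J).sq, (hK.inter hV hJ).sq hV, fun u hu => ?_⟩
    have hle : ((env W).restrict i).tilde (K.inter J) ≤ ((env W).restrict i).tilde K :=
      LieEnv.tilde_mono inf_le_left inf_le_left
    have hu1 := LieEnv.sq_lie_mem_tilde (fun k hk => hw k
      (LieEnv.tilde_mono (J := J) inf_le_right inf_le_right hk)) hu
    have hu2 : u ∈ ((env W).restrict i).tilde (K.inter J) :=
      LieEnv.tilde_sq_le (fun s hs t ht => LieEnv.lie_mem_tilde (LieEnv.tilde_le_sub hs) ht) hu
    rw [leibniz_lie, hp u (hle hu2), zero_lie, zero_add, ← lie_skew, hp _ (hle hu1),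
      _root_.neg_zero]
  ext x
  · exact hpos
  · obtain ⟨J, hJ, hw⟩ := key (ofPos W x)
    refine LieEnv.eq_zero_of_lie_e h.1 hJ (F := env W) ?_
    have hx : ofPos W (p.der.1 x) = ⁅p, ofPos W x⁆ := by
      ext1 <;> simp [hneg, δ_zero_right]
    intro u hu
    change ⁅u, ofPos W (p.der.1 x)⁆ = 0
    rw [hx]; exact hw u hu
  · obtain ⟨J, hJ, hw⟩ := key (ofNeg W x)
    refine LieEnv.eq_zero_of_lie_f h.2 hJ (F := env W) ?_
    have hx : ofNeg W (p.der.2 x) = ⁅p, ofNeg W x⁆ := by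
      ext1 <;> simp [hpos, δ_zero_left]
    intro u hu
    change ⁅u, ofNeg W (p.der.2 x)⁆ = 0
    rw [hx]; exact hw u hu
  · exact hneg

/-- The span of the derivations `δ(x, y)` of `W` with `x, y` in `V`. -/
def Inclusion.derSpan (i : Inclusion V W) : Submodule Φ (Module.End Φ P' × Module.End Φ M') :=
  Submodule.span Φ {d | ∃ x y, d = W.δ (i.pos x) (i.neg y)}

/-- `γ'` extends `γ`. -/
structure Inclusion.Extends (i : Inclusion V W) (γ : Module.End Φ P × Module.End Φ M)
    (γ' : Module.End Φ P' × Module.End Φ M') : Prop where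
  pos : ∀ x, i.pos (γ.1 x) = γ'.1 (i.pos x)
  neg : ∀ y, i.neg (γ.2 y) = γ'.2 (i.neg y)

namespace Inclusion

theorem derSpan_le (i : Inclusion V W) : i.derSpan ≤ W.IDer :=
  Submodule.span_le.2 (by rintro _ ⟨x, y, rfl⟩; exact W.δ_mem _ _)

theorem Extends.add {γ μ : Module.End Φ P × Module.End Φ M}
    {γ' μ' : Module.End Φ P' × Module.End Φ M'} (h : i.Extends γ γ') (h' : i.Extends μ μ') :
    i.Extends (γ + μ) (γ' + μ') :=
  ⟨fun x => by simp [h.pos, h'.pos], fun x => by simp [h.neg, h'.neg]⟩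

theorem Extends.sub {γ μ : Module.End Φ P × Module.End Φ M}
    {γ' μ' : Module.End Φ P' × Module.End Φ M'} (h : i.Extends γ γ') (h' : i.Extends μ μ') :
    i.Extends (γ - μ) (γ' - μ') :=
  ⟨fun x => by simp [h.pos, h'.pos], fun x => by simp [h.neg, h'.neg]⟩

theorem Extends.mul {γ μ : Module.End Φ P × Module.End Φ M}
    {γ' μ' : Module.End Φ P' × Module.End Φ M'} (h : i.Extends γ γ') (h' : i.Extends μ μ') :
    i.Extends (γ * μ) (γ' * μ') :=
  ⟨fun x => by simp [h.pos, h'.pos], fun x => by simp [h.neg, h'.neg]⟩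

theorem Extends.smul {γ : Module.End Φ P × Module.End Φ M}
    {γ' : Module.End Φ P' × Module.End Φ M'} (h : i.Extends γ γ') (a : Φ) :
    i.Extends (a • γ) (a • γ') :=
  ⟨fun x => by simp [h.pos], fun x => by simp [h.neg]⟩

theorem extends_zero (i : Inclusion V W) : i.Extends 0 0 := ⟨fun _ => by simp, fun _ => by simp⟩

theorem extends_δ (i : Inclusion V W) (x : P) (y : M) :
    i.Extends (V.δ x y) (W.δ (i.pos x) (i.neg y)) :=
  ⟨fun z => i.map_triple x y z, fun t => by
    rw [δ_snd_apply, δ_snd_apply, map_neg]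
    exact congrArg Neg.neg (i.op.map_triple y x t)⟩

theorem exists_extends (i : Inclusion V W) {γ : Module.End Φ P × Module.End Φ M}
    (hγ : γ ∈ V.IDer) : ∃ γ' ∈ i.derSpan, i.Extends γ γ' := by
  induction hγ using Submodule.span_induction with
  | mem d hd =>
    obtain ⟨x, y, rfl⟩ := hd
    exact ⟨_, Submodule.subset_span ⟨x, y, rfl⟩, i.extends_δ x y⟩
  | zero => exact ⟨0, zero_mem _, i.extends_zero⟩
  | add γ μ _ _ h h' =>
    obtain ⟨γ', hγ, h⟩ := h
    obtain ⟨μ', hμ, h'⟩ := h'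
    exact ⟨_, add_mem hγ hμ, h.add h'⟩
  | smul a γ _ h =>
    obtain ⟨γ', hγ, h⟩ := h
    exact ⟨_, Submodule.smul_mem _ a hγ, h.smul a⟩

/-- A commutator of chosen extensions must stay in `derSpan`, where uniqueness of extensions holds;
it does, since $\gamma'$ maps $V$ into $V$. -/
theorem comm_mem_derSpan {γ : Module.End Φ P × Module.End Φ M}
    {γ' μ' : Module.End Φ P' × Module.End Φ M'} (h : i.Extends γ γ') (hγ : γ' ∈ i.derSpan)
    (hμ : μ' ∈ i.derSpan) : γ' * μ' - μ' * γ' ∈ i.derSpan := by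
  induction hμ using Submodule.span_induction with
  | mem d hd =>
    obtain ⟨a, b, rfl⟩ := hd
    rw [comm_δ W (i.derSpan_le hγ), ← h.pos, ← h.neg]
    exact add_mem (Submodule.subset_span ⟨_, _, rfl⟩) (Submodule.subset_span ⟨_, _, rfl⟩)
  | zero => simp
  | add μ μ' _ _ h h' =>
    have : γ' * (μ + μ') - (μ + μ') * γ' = (γ' * μ - μ * γ') + (γ' * μ' - μ' * γ') := by
      rw [mul_add, add_mul]; abel
    rw [this]; exact add_mem h h'
  | smul a μ _ h =>
    rw [smul_mul_assoc, mul_smul_comm, ← smul_sub]; exact Submodule.smul_mem _ _ h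

/-- A derivation that vanishes on $V$ commutes with $L=\tilde V$, and $V$ is a dense ideal of
itself. -/
theorem eq_zero_of_extends (hV : V.IsSemiprime) (h : IsPairOfMQuotients i)
    {γ' : Module.End Φ P' × Module.End Φ M'} (hγ : γ' ∈ i.derSpan) (h0 : i.Extends 0 γ') :
    γ' = 0 := by
  have hp : ∀ x, γ'.1 (i.pos x) = 0 := fun x => by rw [← h0.pos]; simp
  have hn : ∀ x, γ'.2 (i.neg x) = 0 := fun x => by rw [← h0.neg]; simp
  have key : ofDer γ' (i.derSpan_le hγ) = 0 := by
    refine eq_zero_of_lie_eq_zero hV h (Ideal.total_annEqZero hV) (fun u hu => ?_)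
    have he : ∀ x, ⁅ofDer γ' (i.derSpan_le hγ), ((env W).restrict i).e x⁆ = 0 := fun x => by
      change ⁅_, ofPos W (i.pos x)⁆ = 0
      ext1 <;> simp [ofDer, δ_zero_right, hp]
    have hf : ∀ x, ⁅ofDer γ' (i.derSpan_le hγ), ((env W).restrict i).f x⁆ = 0 := fun x => by
      change ⁅_, ofNeg W (i.neg x)⁆ = 0
      ext1 <;> simp [ofDer, δ_zero_left, hn]
    have hle : ((env W).restrict i).sub ≤ (⊥ : Submodule Φ W.TKK).comap
        (LieAlgebra.ad Φ W.TKK (ofDer γ' (i.derSpan_le hγ))) := by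
      refine LieEnv.sub_le he hf (fun x y => ?_)
      change ⁅ofDer γ' (i.derSpan_le hγ), ⁅((env W).restrict i).e x, ((env W).restrict i).f y⁆⁆ = 0
      rw [leibniz_lie, he, hf, zero_lie, lie_zero, add_zero]
    rw [← lie_skew, show ⁅ofDer γ' (i.derSpan_le hγ), u⁆ = 0 from hle hu, _root_.neg_zero]
  exact congrArg TKK.der key

theorem eq_of_extends (hV : V.IsSemiprime) (h : IsPairOfMQuotients i)
    {γ : Module.End Φ P × Module.End Φ M} {γ' μ' : Module.End Φ P' × Module.End Φ M'}
    (hγ : γ' ∈ i.derSpan) (hμ : μ' ∈ i.derSpan) (h1 : i.Extends γ γ') (h2 : i.Extends γ μ') :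
    γ' = μ' := by
  have h3 := h1.sub h2
  rw [sub_self] at h3
  exact sub_eq_zero.1 (eq_zero_of_extends hV h (sub_mem hγ hμ) h3)

/-- On $\mathrm{IDer}(V)$ the map sends $\gamma$ to its unique extension in `derSpan`. Uniqueness
makes this choice linear and compatible with brackets; injectivity holds because an extension
determines $\gamma$. -/
theorem exists_lieHom (hV : V.IsSemiprime) (h : IsPairOfMQuotients i) :
    ∃ φ : V.TKK →ₗ⁅Φ⁆ W.TKK, Function.Injective φ ∧
      (∀ x, φ (ofPos V x) = ofPos W (i.pos x)) ∧ ∀ y, φ (ofNeg V y) = ofNeg W (i.neg y) := by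
  choose g hg hext using fun t : V.TKK => i.exists_extends t.der_mem
  have uniq : ∀ t μ', μ' ∈ i.derSpan → i.Extends t.der μ' → g t = μ' := fun t μ' hμ hμ' =>
    eq_of_extends hV h (hg t) hμ (hext t) hμ'
  let φ : V.TKK →ₗ⁅Φ⁆ W.TKK :=
    { toFun := fun t => TKK.mk (i.pos t.pos) (g t) (i.derSpan_le (hg t)) (i.neg t.neg)
      map_add' := fun s t => by
        ext1
        · simp
        · exact uniq _ _ (add_mem (hg s) (hg t)) ((hext s).add (hext t))
        · simp
      map_smul' := fun a t => by
        ext1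
        · simp
        · exact uniq _ _ (Submodule.smul_mem _ a (hg t)) ((hext t).smul a)
        · simp
      map_lie' := fun {s t} => by
        ext1
        · simp [(hext s).pos, (hext t).pos]
        · refine uniq _ _ ?_ ?_
          · exact sub_mem (add_mem (comm_mem_derSpan (hext s) (hg s) (hg t))
              (Submodule.subset_span ⟨_, _, rfl⟩)) (Submodule.subset_span ⟨_, _, rfl⟩)
          · exact ((((hext s).mul (hext t)).sub ((hext t).mul (hext s))).add
              (i.extends_δ _ _)).sub (i.extends_δ _ _)
        · simp [(hext s).neg, (hext t).neg] }
  refine ⟨φ, fun s t hst => ?_, fun x => ?_, fun y => ?_⟩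
  · have hg' : g s = g t := congrArg TKK.der hst
    ext x
    · exact i.pos_injective (congrArg TKK.pos hst)
    · refine i.pos_injective ?_
      change i.pos (s.der.1 x) = i.pos (t.der.1 x)
      rw [(hext s).pos, (hext t).pos, hg']
    · refine i.neg_injective ?_
      change i.neg (s.der.2 x) = i.neg (t.der.2 x)
      rw [(hext s).neg, (hext t).neg, hg']
    · exact i.neg_injective (congrArg TKK.neg hst)
  · ext1
    · rfl
    · exact uniq _ _ (zero_mem _) i.extends_zero
    · exact map_zero i.neg
  · ext1
    · exact map_zero i.pos
    · exact uniq _ _ (zero_mem _) i.extends_zero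
    · rfl

end Inclusion

/-- $V^\pm$ generate $\mathrm{TKK}(V)$, so the image is $L$ whatever the homomorphism. -/
theorem range_eq_sub {φ : V.TKK →ₗ⁅Φ⁆ W.TKK}
    (h1 : ∀ x, φ (ofPos V x) = ofPos W (i.pos x)) (h2 : ∀ y, φ (ofNeg V y) = ofNeg W (i.neg y)) :
    φ.range.toSubmodule = ((env W).restrict i).sub := by
  apply le_antisymm
  · rintro _ ⟨t, rfl⟩
    suffices h : (env V).sub ≤ ((env W).restrict i).sub.comap (φ : V.TKK →ₗ[Φ] W.TKK) by
      rw [sub_env] at h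
      exact h (Submodule.mem_top : t ∈ (⊤ : Submodule Φ V.TKK))
    refine LieEnv.sub_le (fun x => ?_) (fun y => ?_) (fun x y => ?_)
    · change φ (ofPos V x) ∈ ((env W).restrict i).sub
      rw [h1]; exact LieEnv.e_mem_sub (E := (env W).restrict i) x
    · change φ (ofNeg V y) ∈ ((env W).restrict i).sub
      rw [h2]; exact LieEnv.f_mem_sub (E := (env W).restrict i) y
    · change φ ⁅ofPos V x, ofNeg V y⁆ ∈ ((env W).restrict i).sub
      rw [LieHom.map_lie, h1, h2]; exact LieEnv.lie_mem_sub (E := (env W).restrict i) x y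
  · have he : ∀ x, ((env W).restrict i).e x ∈ φ.range := fun x => ⟨ofPos V x, h1 x⟩
    have hf : ∀ y, ((env W).restrict i).f y ∈ φ.range := fun y => ⟨ofNeg V y, h2 y⟩
    exact LieEnv.sub_le he hf (fun x y => φ.range.lie_mem (he x) (hf y))

theorem isAlgebraOfQuotients_of_isPairOfMQuotients (hV : V.IsSemiprime)
    (h : IsPairOfMQuotients i) {L : LieSubalgebra Φ W.TKK}
    (hL : L.toSubmodule = ((env W).restrict i).sub) : L.IsAlgebraOfQuotients := by
  have hmem : ∀ t, t ∈ L ↔ t ∈ ((env W).restrict i).sub := fun t => by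
    rw [← hL, LieSubalgebra.mem_toSubmodule]
  intro p q hp
  obtain ⟨K, hK, hq⟩ := absorbed_of_isPairOfMQuotients hV h q
  have hex : ∃ x ∈ ((env W).restrict i).tilde K, ⁅x, p⁆ ≠ 0 := by
    by_contra! hcon
    exact hp (eq_zero_of_lie_eq_zero hV h hK hcon)
  obtain ⟨x, hx, hxp⟩ := hex
  refine ⟨x, (hmem x).2 (LieEnv.tilde_le_sub hx), hxp, fun m hm => (hmem _).2 ?_⟩
  -- The elements sent into $L$ by all of $\tilde K$ form an $L$-stable submodule, since $\tilde K$
  -- is an ideal; a single $x$ would not give a stable condition.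
  suffices hle : L.adSpan q ≤ ⨅ u ∈ ((env W).restrict i).tilde K,
      ((env W).restrict i).sub.comap (LieAlgebra.ad Φ W.TKK u) by
    have := hle hm
    simp only [Submodule.mem_iInf] at this
    exact this x hx
  refine LieSubalgebra.adSpan_le ?_ (fun y hy s hs => ?_)
  · simp only [Submodule.mem_iInf]
    exact hq
  · rw [hmem] at hy
    simp only [Submodule.mem_iInf] at hs ⊢
    intro u hu
    change ⁅u, ⁅y, s⁆⁆ ∈ ((env W).restrict i).sub
    rw [leibniz_lie]
    exact add_mem (hs _ (LieEnv.lie_mem_tilde' hy hu)) (LieEnv.lie_mem_tilde hy (hs u hu))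

end Forward

end JordanPair

/-! ### From a separating graded ideal of $L$ to a dense ideal of $V$ -/

namespace JordanPair

section Backward

variable {Φ : Type u} [CommRing Φ] [Invertible (2 : Φ)]
  {P : Type v} {M : Type w} [AddCommGroup P] [Module Φ P] [AddCommGroup M] [Module Φ M]
  {V : JordanPair Φ P M}
  {P' : Type v'} {M' : Type w'} [AddCommGroup P'] [Module Φ P'] [AddCommGroup M'] [Module Φ M']
  {W : JordanPair Φ P' M'} {i : Inclusion V W}
  {T : Type*} [LieRing T] [LieAlgebra Φ T]

/-- The ideal of `V` given by a submodule that is stable under the subalgebra generated by `V`. -/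
def LieEnv.idealOfStable (E : LieEnv V T) (N : Submodule Φ T)
    (hN : ∀ l ∈ E.sub, ∀ u ∈ N, ⁅l, u⁆ ∈ N) : V.Ideal where
  pos := N.comap E.e
  neg := N.comap E.f
  isIdeal_pos := isIdealPos_of_triple
    (fun x y z hz => by
      rw [Submodule.mem_comap, ← E.lie_e_f_e]
      exact hN _ (LieEnv.lie_mem_sub x y) _ hz)
    (fun x y hy z => by
      rw [Submodule.mem_comap, ← E.lie_e_f_e]
      exact LieEnv.lie_mem_comm.2
        (hN _ (LieEnv.e_mem_sub z) _ (hN _ (LieEnv.e_mem_sub x) _ hy)))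
  isIdeal_neg := isIdealPos_of_triple
    (fun x y z hz => by
      rw [Submodule.mem_comap, ← E.lie_f_e_f]
      exact hN _ (LieEnv.lie_mem_comm.2 (LieEnv.lie_mem_sub y x)) _ hz)
    (fun x y hy z => by
      rw [Submodule.mem_comap, ← E.lie_f_e_f]
      exact LieEnv.lie_mem_comm.2
        (hN _ (LieEnv.f_mem_sub z) _ (hN _ (LieEnv.f_mem_sub x) _ hy)))

/-- A graded ideal `N` of the subalgebra generated by `V` whose elements separate the elements of
the algebra, for a faithful embedding that reflects membership in `V`. -/
structure Separating (F : LieEnv W T) (i : Inclusion V W) (N : Submodule Φ T) : Prop where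
  le : N ≤ (F.restrict i).sub
  lie_mem : ∀ l ∈ (F.restrict i).sub, ∀ u ∈ N, ⁅l, u⁆ ∈ N
  faithful : ∀ d ∈ (F.restrict i).sub, (∀ x, ⁅d, (F.restrict i).e x⁆ = 0) →
    (∀ y, ⁅d, (F.restrict i).f y⁆ = 0) → d = 0
  mem_pos : ∀ w, F.e w ∈ (F.restrict i).sub → w ∈ i.pos.range
  mem_neg : ∀ w, F.f w ∈ (F.restrict i).sub → w ∈ i.neg.range
  decomp : ∀ x ∈ N, ∃ a b d, (F.restrict i).e a ∈ N ∧ (F.restrict i).f b ∈ N ∧ d ∈ N ∧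
    x = (F.restrict i).e a + d + (F.restrict i).f b ∧
    (∀ w, ∃ w', ⁅d, F.e w⁆ = F.e w') ∧ ∀ w, ∃ w', ⁅d, F.f w⁆ = F.f w'
  exists_ne : ∀ p : T, p ≠ 0 → ∃ x ∈ N, ⁅x, p⁆ ≠ 0

theorem sub_restrict_op (F : LieEnv W T) (i : Inclusion V W) :
    (F.op.restrict i.op).sub = (F.restrict i).sub :=
  LieEnv.tilde_op (E := F.restrict i) (I := Ideal.total V)

namespace Separating

variable {F : LieEnv W T} {N : Submodule Φ T}

theorem op (h : Separating F i N) : Separating F.op i.op N where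
  le := by rw [sub_restrict_op]; exact h.le
  lie_mem := by rw [sub_restrict_op]; exact h.lie_mem
  faithful := by rw [sub_restrict_op]; exact fun d hd h1 h2 => h.faithful d hd h2 h1
  mem_pos := by rw [sub_restrict_op]; exact h.mem_neg
  mem_neg := by rw [sub_restrict_op]; exact h.mem_pos
  decomp := fun x hx => by
    obtain ⟨a, b, d, h1, h2, h3, h4, h5, h6⟩ := h.decomp x hx
    refine ⟨b, a, d, h2, h1, h3, ?_, h6, h5⟩
    rw [h4, add_comm, add_comm (((F.restrict i).e) a), ← add_assoc]
    rfl
  exists_ne := h.exists_ne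

/-- The ideal `N ∩ V`. -/
def ideal (h : Separating F i N) : V.Ideal := (F.restrict i).idealOfStable N h.lie_mem

/-- Brackets of $z$ with $[I^+,V^-]$ and $[V^+,I^-]$ are triple products up to sign. The bracket
$[b,z]$ acts on $V$ by such products, so it acts as zero; being in $L$, it vanishes by faithfulness.
-/
theorem lie_eq_zero (h : Separating F i N) {z : P'}
    (hz : ∀ b ∈ h.ideal.neg, ⁅(F.restrict i).f b, F.e z⁆ ∈ (F.restrict i).sub)
    (h1 : ∀ b ∈ h.ideal.neg, ∀ x, W.triple z (i.neg b) (i.pos x) = 0)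
    (h2 : ∀ y, ∀ a ∈ h.ideal.pos, W.triple z (i.neg y) (i.pos a) = 0)
    (h3 : ∀ b ∈ h.ideal.neg, ∀ y, W.op.triple (i.neg b) z (i.neg y) = 0) :
    ∀ u ∈ (F.restrict i).tilde h.ideal, ⁅u, F.e z⁆ = 0 := by
  have skew : ∀ s t : T, ⁅t, s⁆ = 0 → ⁅s, t⁆ = 0 := fun s t h => by
    rw [← lie_skew, h, _root_.neg_zero]
  suffices hle : (F.restrict i).tilde h.ideal ≤
      (⊥ : Submodule Φ T).comap (LieAlgebra.ad Φ T (F.e z)) from fun u hu => skew _ _ (hle hu)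
  refine LieEnv.tilde_le (fun a ha => F.lie_e_e _ _) (fun b hb => skew _ _ ?_)
    (fun a ha y => skew _ _ ?_) (fun x b hb => skew _ _ ?_)
  · refine h.faithful _ (hz b hb) (fun x => ?_) (fun y => ?_)
    · rw [← lie_skew ((F.restrict i).f b), neg_lie, LieEnv.restrict_f, LieEnv.restrict_e,
        F.lie_e_f_e, h1 b hb, map_zero, _root_.neg_zero]
    · rw [LieEnv.restrict_f, LieEnv.restrict_f, F.lie_f_e_f, h3 b hb, map_zero]
  · rw [LieEnv.restrict_f, LieEnv.restrict_e, F.lie_e_f_e, triple_comm, h2 y a ha, map_zero]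
  · rw [LieEnv.restrict_f, LieEnv.restrict_e, F.lie_e_f_e, triple_comm, h1 b hb, map_zero]

/-- Stated with the weak hypothesis `hann` because it is used twice: to prove that $I=N\cap V$ is
dense, and then, with density known, to show that some product of $q$ is nonzero. -/
theorem eq_zero_of_lie (h : Separating F i N) {z : P'}
    (hz : ∀ u ∈ (F.restrict i).tilde h.ideal, ⁅u, F.e z⁆ = 0)
    (hmem : ∀ d ∈ N, ⁅d, F.e z⁆ ∈ (F.restrict i).sub)
    (hann : ∀ d ∈ N, ∀ r ∈ h.ideal.ann.pos, ⁅d, F.e z⁆ = (F.restrict i).e r → r = 0) :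
    z = 0 := by
  by_contra hz0
  obtain ⟨x, hx, hne⟩ := h.exists_ne (F.e z) (fun h0 => hz0 (F.e_injective (by rw [h0, map_zero])))
  obtain ⟨a, b, d, ha, hb, hd, rfl, hdeg, -⟩ := h.decomp x hx
  refine hne ?_
  -- Since $d$ has degree zero, $[d,z]$ lies in $W^+\cap L=V^+$, and $\tilde I$ kills it as it kills
  -- $z$.
  have hd0 : ⁅d, F.e z⁆ = 0 := by
    obtain ⟨w', hw⟩ := hdeg z
    have hk := LieEnv.lie_eq_zero_of_lie (h.le hd) hz
    have hs := hmem d hd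
    rw [hw] at hs hk
    obtain ⟨r, rfl⟩ := h.mem_pos w' hs
    have := hann d hd r (LieEnv.mem_annPos_of_lie_eq_zero (E := F.restrict i) hk) hw
    rw [hw, this, map_zero, map_zero]
  rw [add_lie, add_lie, hz _ (LieEnv.e_mem ha), hz _ (LieEnv.f_mem hb), hd0, add_zero, add_zero]

/-- For $z\in\mathrm{Ann}_V(I)^+$ and $d\in N$, the bracket $[d,z]$ stays in the ideal $N$; an
element of $V^+$ equal to it and annihilating $I$ lies in $I\cap\mathrm{Ann}_V(I)=0$. -/
theorem annPos_ideal (hV : V.IsSemiprime) (h : Separating F i N) :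
    V.annPos h.ideal.pos h.ideal.neg = {0} := by
  refine Set.eq_singleton_iff_unique_mem.2 ⟨h.ideal.annSubmodule.zero_mem, fun z hz => ?_⟩
  obtain ⟨h1, h2, h3⟩ := hz
  have hN : ∀ d ∈ N, ⁅d, (F.restrict i).e z⁆ ∈ N := fun d hd =>
    LieEnv.lie_mem_comm.2 (h.lie_mem _ (LieEnv.e_mem_sub z) d hd)
  refine (map_eq_zero_iff i.pos i.pos_injective).1 (h.eq_zero_of_lie (h.lie_eq_zero
    (fun b hb => h.le (hN _ hb)) (fun b hb x => ?_) (fun y a ha => ?_) (fun b hb y => ?_))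
    (fun d hd => h.le (hN d hd)) (fun d hd r hr hdr => ?_))
  · rw [← i.map_triple, h1 b hb, map_zero]
  · rw [← i.map_triple, h2 y a ha, map_zero]
  · refine (i.op.map_triple b z y).symm.trans ?_
    rw [V.op.triple_comm, h3 y b hb, map_zero]
  · have hr' : r ∈ (h.ideal.inter h.ideal.ann).pos := by
      refine ⟨?_, hr⟩
      change (F.restrict i).e r ∈ N
      rw [← hdr]; exact hN d hd
    rwa [(Ideal.inter_ann_isZero hV h.ideal).1, Submodule.mem_bot] at hr'

theorem annEqZero (hV : V.IsSemiprime) (h : Separating F i N) : h.ideal.AnnEqZero :=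
  ⟨h.annPos_ideal hV, h.op.annPos_ideal hV.op⟩

theorem absorbs (hV : V.IsSemiprime) (h : Separating F i N) {q : P'} (hq0 : q ≠ 0)
    (hq : ∀ u ∈ N, ⁅u, F.e q⁆ ∈ (F.restrict i).sub) : ∃ I : V.Ideal, I.AnnEqZero ∧
    (∀ b ∈ I.neg, ∀ x, W.triple q (i.neg b) (i.pos x) ∈ i.pos.range) ∧
    (∀ y, ∀ a ∈ I.pos, W.triple q (i.neg y) (i.pos a) ∈ i.pos.range) ∧
    (∀ b ∈ I.neg, ∀ y, W.op.triple (i.neg b) q (i.neg y) ∈ i.neg.range) ∧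
    ((∃ b ∈ I.neg, ∃ x, W.triple q (i.neg b) (i.pos x) ≠ 0) ∨
     (∃ y, ∃ a ∈ I.pos, W.triple q (i.neg y) (i.pos a) ≠ 0) ∨
     (∃ b ∈ I.neg, ∃ y, W.op.triple (i.neg b) q (i.neg y) ≠ 0)) := by
  refine ⟨h.ideal, h.annEqZero hV, fun b hb x => h.mem_pos _ ?_, fun y a ha => h.mem_pos _ ?_,
    fun b hb y => h.mem_neg _ ?_, ?_⟩
  · rw [← F.lie_e_f_e]
    exact LieEnv.lie_mem_tilde' (E := F.restrict i) (LieEnv.e_mem_sub x)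
      (LieEnv.lie_mem_comm.2 (hq _ hb))
  · rw [triple_comm, ← F.lie_e_f_e]
    exact hq _ (LieEnv.lie_mem_comm.2 (h.lie_mem _ (LieEnv.f_mem_sub y) _ ha))
  · rw [← F.lie_f_e_f]
    exact LieEnv.lie_mem_tilde' (E := F.restrict i) (LieEnv.f_mem_sub y) (hq _ hb)
  · by_contra! hcon
    obtain ⟨h1, h2, h3⟩ := hcon
    refine hq0 (h.eq_zero_of_lie (h.lie_eq_zero (fun b hb => hq _ hb) h1 h2 h3) hq
      (fun d _ r hr _ => ?_))
    change r ∈ V.annPos h.ideal.pos h.ideal.neg at hr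
    rwa [h.annPos_ideal hV] at hr

end Separating

end Backward

end JordanPair

/-! ### Graded submodules of $\mathrm{TKK}(W)$ and the denominators of a homogeneous element -/

namespace JordanPair

section Graded

variable {Φ : Type u} [CommRing Φ] [Invertible (2 : Φ)]
  {P : Type v} {M : Type w} [AddCommGroup P] [Module Φ P] [AddCommGroup M] [Module Φ M]
  {V : JordanPair Φ P M}
  {P' : Type v'} {M' : Type w'} [AddCommGroup P'] [Module Φ P'] [AddCommGroup M'] [Module Φ M']
  {W : JordanPair Φ P' M'} {i : Inclusion V W}

namespace TKK

/-- The projection of `TKK(V)` onto `V⁺`. -/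
def posHom (V : JordanPair Φ P M) : V.TKK →ₗ[Φ] P where
  toFun := pos
  map_add' _ _ := rfl
  map_smul' _ _ := rfl

/-- The projection of `TKK(V)` onto `V⁻`. -/
def negHom (V : JordanPair Φ P M) : V.TKK →ₗ[Φ] M where
  toFun := neg
  map_add' _ _ := rfl
  map_smul' _ _ := rfl

/-- A graded submodule of `TKK(V)`. -/
def Graded (S : Submodule Φ V.TKK) : Prop :=
  ∀ t ∈ S, ofPos V t.pos ∈ S ∧ ofNeg V t.neg ∈ S

theorem ofDer_mem {S : Submodule Φ V.TKK} {t : V.TKK} (ht : t ∈ S) (hp : ofPos V t.pos ∈ S)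
    (hn : ofNeg V t.neg ∈ S) : ofDer t.der t.der_mem ∈ S := by
  have h : ofDer t.der t.der_mem = t - ofPos V t.pos - ofNeg V t.neg := by
    rw [eq_sub_iff_add_eq, eq_sub_iff_add_eq]
    refine Eq.trans ?_ (eq_add t).symm
    change _ = ofPos V t.pos + _ + ofNeg V t.neg
    abel
  rw [h]
  exact sub_mem (sub_mem ht hp) hn

theorem Graded.der_mem {S : Submodule Φ V.TKK} (hS : Graded S) {t : V.TKK} (ht : t ∈ S) :
    ofDer t.der t.der_mem ∈ S :=
  ofDer_mem ht (hS t ht).1 (hS t ht).2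

theorem graded_iff_le {S : Submodule Φ V.TKK} : Graded S ↔
    S ≤ S.comap ((env V).e ∘ₗ posHom V) ⊓ S.comap ((env V).f ∘ₗ negHom V) := Iff.rfl

theorem pos_mem_range {t : W.TKK} (ht : t ∈ ((env W).restrict i).sub) : t.pos ∈ i.pos.range := by
  suffices h : ((env W).restrict i).sub ≤ i.pos.range.comap (posHom W) from h ht
  refine LieEnv.sub_le (fun x => ⟨x, rfl⟩) (fun y => ⟨0, map_zero _⟩) (fun x y => ⟨0, ?_⟩)
  change _ = (⁅ofPos W _, ofNeg W _⁆ : W.TKK).pos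
  simp

theorem neg_mem_range {t : W.TKK} (ht : t ∈ ((env W).restrict i).sub) : t.neg ∈ i.neg.range := by
  suffices h : ((env W).restrict i).sub ≤ i.neg.range.comap (negHom W) from h ht
  refine LieEnv.sub_le (fun x => ⟨0, map_zero _⟩) (fun y => ⟨y, rfl⟩) (fun x y => ⟨0, ?_⟩)
  change _ = (⁅ofPos W _, ofNeg W _⁆ : W.TKK).neg
  simp

theorem graded_sub : Graded ((env W).restrict i).sub := by
  intro t ht
  obtain ⟨x, hx⟩ := pos_mem_range ht
  obtain ⟨y, hy⟩ := neg_mem_range ht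
  rw [← hx, ← hy]
  exact ⟨LieEnv.e_mem_sub (E := (env W).restrict i) x,
    LieEnv.f_mem_sub (E := (env W).restrict i) y⟩

/-- Homogeneity of $q$ enters here: both outer components of $q$ must already lie in ${}_L(q)$. -/
theorem graded_adSpan {L : LieSubalgebra Φ V.TKK} (hL : Graded L.toSubmodule) {q : V.TKK}
    (hp : ofPos V q.pos ∈ L.adSpan q) (hn : ofNeg V q.neg ∈ L.adSpan q) :
    Graded (L.adSpan q) := by
  suffices h : L.adSpan q ≤ L.adSpan q ⊓ ((L.adSpan q).comap ((env V).e ∘ₗ posHom V) ⊓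
      (L.adSpan q).comap ((env V).f ∘ₗ negHom V)) from graded_iff_le.2 (h.trans inf_le_right)
  refine LieSubalgebra.adSpan_le ⟨LieSubalgebra.self_mem_adSpan, hp, hn⟩ ?_
  rintro x hx m ⟨hm, hm1, hm2⟩
  have hm0 : ofDer m.der m.der_mem ∈ L.adSpan q := ofDer_mem hm hm1 hm2
  have hx0 : ofDer x.der x.der_mem ∈ L := hL.der_mem hx
  have hx1 : ofPos V x.pos ∈ L := (hL x hx).1
  have hx2 : ofNeg V x.neg ∈ L := (hL x hx).2
  refine ⟨LieSubalgebra.lie_mem_adSpan hx hm, ?_, ?_⟩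
  · have h : ofPos V ⁅x, m⁆.pos =
        ⁅ofDer x.der x.der_mem, ofPos V m.pos⁆ + ⁅ofPos V x.pos, ofDer m.der m.der_mem⁆ := by
      ext1 <;> simp [ofDer, δ_zero_right, sub_eq_add_neg]
    change ofPos V ⁅x, m⁆.pos ∈ L.adSpan q
    rw [h]
    exact add_mem (LieSubalgebra.lie_mem_adSpan hx0 hm1) (LieSubalgebra.lie_mem_adSpan hx1 hm0)
  · have h : ofNeg V ⁅x, m⁆.neg =
        ⁅ofDer x.der x.der_mem, ofNeg V m.neg⁆ + ⁅ofNeg V x.neg, ofDer m.der m.der_mem⁆ := by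
      ext1 <;> simp [ofDer, δ_zero_left, sub_eq_add_neg]
    change ofNeg V ⁅x, m⁆.neg ∈ L.adSpan q
    rw [h]
    exact add_mem (LieSubalgebra.lie_mem_adSpan hx0 hm2) (LieSubalgebra.lie_mem_adSpan hx2 hm0)

/-- The elements `x ∈ L` with `[x, S] ⊆ L`. -/
def denominators (L S : Submodule Φ V.TKK) : Submodule Φ V.TKK :=
  L ⊓ ⨅ m ∈ S, L.comap (LieAlgebra.ad Φ V.TKK m)

theorem mem_denominators {L S : Submodule Φ V.TKK} {x : V.TKK} :
    x ∈ denominators L S ↔ x ∈ L ∧ ∀ m ∈ S, ⁅x, m⁆ ∈ L := by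
  simp only [denominators, Submodule.mem_inf, Submodule.mem_iInf]
  exact and_congr Iff.rfl (forall₂_congr fun m _ => LieEnv.lie_mem_comm)

/-- The bracket of an outer component $x^\pm$ with $m$ is assembled from homogeneous parts of the
brackets of $x$ with homogeneous parts of $m$, all of which lie in the graded $L$. -/
theorem graded_denominators {L S : Submodule Φ V.TKK} (hL : Graded L) (hS : Graded S) :
    Graded (denominators L S) := by
  intro x hx
  rw [mem_denominators] at hx
  obtain ⟨hx, h⟩ := hx
  refine ⟨mem_denominators.2 ⟨(hL x hx).1, fun m hm => ?_⟩,
    mem_denominators.2 ⟨(hL x hx).2, fun m hm => ?_⟩⟩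
  · have e : ⁅ofPos V x.pos, m⁆ = ofPos V ⁅x, ofDer m.der m.der_mem⁆.pos +
        ofDer ⁅x, ofNeg V m.neg⁆.der (TKK.der_mem _) := by
      ext1 <;> simp [ofDer, δ_zero_right, δ_zero_left]
    rw [e]
    exact add_mem (hL _ (h _ (hS.der_mem hm))).1 (hL.der_mem (h _ (hS m hm).2))
  · have e : ⁅ofNeg V x.neg, m⁆ = ofNeg V ⁅x, ofDer m.der m.der_mem⁆.neg +
        ofDer ⁅x, ofPos V m.pos⁆.der (TKK.der_mem _) := by
      ext1 <;> simp [ofDer, δ_zero_right, δ_zero_left]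
    rw [e]
    exact add_mem (hL _ (h _ (hS.der_mem hm))).2 (hL.der_mem (h _ (hS m hm).1))

/-- The centre of `TKK(V)` is zero. -/
theorem eq_zero_of_lie_eq_zero (hV : V.IsSemiprime) {a : V.TKK} (h1 : ∀ x, ⁅a, ofPos V x⁆ = 0)
    (h2 : ∀ y, ⁅a, ofNeg V y⁆ = 0) : a = 0 := by
  have hpos : ∀ y, V.δ a.pos y = 0 := fun y => by
    simpa [δ_zero_left, δ_zero_right] using congrArg TKK.der (h2 y)
  have hneg : ∀ x, V.δ x a.neg = 0 := fun x => by
    simpa [δ_zero_left, δ_zero_right] using congrArg TKK.der (h1 x)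
  have hp : ∀ y z, V.triple a.pos y z = 0 := fun y z => by
    rw [← δ_fst_apply, hpos]; rfl
  have hp' : ∀ y t, V.op.triple y a.pos t = 0 := fun y t => by
    rw [← neg_eq_zero, ← δ_snd_apply, hpos]; rfl
  have hn : ∀ x t, V.op.triple a.neg x t = 0 := fun x t => by
    rw [← neg_eq_zero, ← δ_snd_apply, hneg]; rfl
  have hn' : ∀ x z, V.triple x a.neg z = 0 := fun x z => by
    rw [← δ_fst_apply, hneg]; rfl
  have ht := Ideal.total_annEqZero hV
  ext x
  · have : a.pos ∈ V.annPos (Ideal.total V).pos (Ideal.total V).neg :=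
      ⟨fun _ _ _ => hp _ _, fun _ _ _ => hp _ _, fun _ _ _ => hp' _ _⟩
    rwa [ht.1] at this
  · simpa using congrArg TKK.pos (h1 x)
  · simpa using congrArg TKK.neg (h2 x)
  · have : a.neg ∈ V.op.annPos (Ideal.total V).neg (Ideal.total V).pos :=
      ⟨fun _ _ _ => hn _ _, fun _ _ _ => hn _ _, fun _ _ _ => hn' _ _⟩
    rwa [ht.2] at this

end TKK

open TKK

/-- Faithfulness is the triviality of the centre of $\mathrm{TKK}(V)$, transported by the injective
$\varphi$; separation of points is the quotient property for this fixed $q$ and arbitrary $p$. -/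
theorem separating_denominators (hV : V.IsSemiprime) {φ : V.TKK →ₗ⁅Φ⁆ W.TKK}
    (hφ : Function.Injective φ)
    (h1 : ∀ x, φ (ofPos V x) = ofPos W (i.pos x)) (h2 : ∀ y, φ (ofNeg V y) = ofNeg W (i.neg y))
    (hQ : φ.range.IsAlgebraOfQuotients) {q : W.TKK}
    (hp : ofPos W q.pos ∈ φ.range.adSpan q) (hn : ofNeg W q.neg ∈ φ.range.adSpan q) :
    Separating (env W) i (denominators ((env W).restrict i).sub (φ.range.adSpan q)) := by
  have hL := range_eq_sub h1 h2
  have hmem : ∀ t, t ∈ φ.range ↔ t ∈ ((env W).restrict i).sub := fun t => by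
    rw [← hL, LieSubalgebra.mem_toSubmodule]
  have hg := graded_denominators (graded_sub (i := i))
    (graded_adSpan (by rw [hL]; exact graded_sub (i := i)) hp hn)
  refine ⟨fun x hx => (mem_denominators.1 hx).1, fun l hl u hu => ?_, fun d hd he hf => ?_,
    fun w hw => pos_mem_range hw, fun w hw => neg_mem_range hw, fun x hx => ?_, fun p hp0 => ?_⟩
  · rw [mem_denominators] at hu ⊢
    refine ⟨LieEnv.lie_mem_tilde hl hu.1, fun m hm => ?_⟩
    -- $[[l,u],m]=[l,[u,m]]-[u,[l,m]]$, and $[l,m]$ stays in ${}_L(q)$: this is why the quotient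
    -- condition involves ${}_L(q)$ and not only $q$.
    rw [lie_lie]
    exact sub_mem (LieEnv.lie_mem_tilde hl (hu.2 m hm))
      (hu.2 _ (LieSubalgebra.lie_mem_adSpan ((hmem l).2 hl) hm))
  · obtain ⟨a, rfl⟩ := (hmem d).2 hd
    have ha : a = 0 := TKK.eq_zero_of_lie_eq_zero hV
      (fun x => hφ (by rw [LieHom.map_lie, h1, map_zero]; exact he x))
      (fun y => hφ (by rw [LieHom.map_lie, h2, map_zero]; exact hf y))
    rw [ha]; exact map_zero φ
  · have hxs := (mem_denominators.1 hx).1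
    obtain ⟨a, ha⟩ := pos_mem_range hxs
    obtain ⟨b, hb⟩ := neg_mem_range hxs
    have ea : ((env W).restrict i).e a = ofPos W x.pos := congrArg (ofPos W) ha
    have eb : ((env W).restrict i).f b = ofNeg W x.neg := congrArg (ofNeg W) hb
    refine ⟨a, b, ofDer x.der x.der_mem, ?_, ?_, hg.der_mem hx, ?_,
      fun w => ⟨x.der.1 w, ?_⟩, fun w => ⟨x.der.2 w, ?_⟩⟩
    · rw [ea]; exact (hg x hx).1
    · rw [eb]; exact (hg x hx).2
    · rw [ea, eb]; exact eq_add x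
    · change ⁅_, ofPos W w⁆ = ofPos W _
      ext1 <;> simp [ofDer, δ_zero_right]
    · change ⁅_, ofNeg W w⁆ = ofNeg W _
      ext1 <;> simp [ofDer, δ_zero_left]
  · obtain ⟨x, hx, hxp, hxm⟩ := hQ p q hp0
    exact ⟨x, mem_denominators.2 ⟨(hmem x).1 hx, fun m hm => (hmem _).1 (hxm m hm)⟩, hxp⟩

theorem isPairOfMQuotients_of_isAlgebraOfQuotients (hV : V.IsSemiprime)
    {φ : V.TKK →ₗ⁅Φ⁆ W.TKK} (hφ : Function.Injective φ)
    (h1 : ∀ x, φ (ofPos V x) = ofPos W (i.pos x)) (h2 : ∀ y, φ (ofNeg V y) = ofNeg W (i.neg y))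
    (hQ : φ.range.IsAlgebraOfQuotients) : IsPairOfMQuotients i := by
  have hz : ofNeg W 0 = 0 := (env W).f.map_zero
  have hz' : ofPos W 0 = 0 := (env W).e.map_zero
  constructor
  · intro q hq
    have h := separating_denominators (q := ofPos W q) hV hφ h1 h2 hQ
      LieSubalgebra.self_mem_adSpan (by rw [neg_ofPos, hz]; exact zero_mem _)
    exact h.absorbs hV hq fun u hu => (mem_denominators.1 hu).2 _ LieSubalgebra.self_mem_adSpan
  · intro q hq
    have h := separating_denominators (q := ofNeg W q) hV hφ h1 h2 hQ
      (by rw [pos_ofNeg, hz']; exact zero_mem _) LieSubalgebra.self_mem_adSpan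
    refine h.op.absorbs hV.op hq fun u hu => ?_
    rw [sub_restrict_op]
    exact (mem_denominators.1 hu).2 _ LieSubalgebra.self_mem_adSpan

end Graded

end JordanPair

theorem mainTheorem3 {Φ : Type*} [CommRing Φ] [Invertible (2 : Φ)]
    {Vp Vm Wp Wm : Type*} [AddCommGroup Vp] [Module Φ Vp] [AddCommGroup Vm] [Module Φ Vm]
    [AddCommGroup Wp] [Module Φ Wp] [AddCommGroup Wm] [Module Φ Wm]
    (V : JordanPair Φ Vp Vm) (W : JordanPair Φ Wp Wm) (i : JordanPair.Inclusion V W)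
    (hV : V.IsSemiprime) :
    JordanPair.IsPairOfMQuotients i ↔
      ∃ φ : V.TKK →ₗ⁅Φ⁆ W.TKK, Function.Injective φ ∧
        (∀ x : Vp, φ (JordanPair.TKK.ofPos V x) = JordanPair.TKK.ofPos W (i.pos x)) ∧
        (∀ y : Vm, φ (JordanPair.TKK.ofNeg V y) = JordanPair.TKK.ofNeg W (i.neg y)) ∧
        φ.range.IsAlgebraOfQuotients := by
  constructor
  · intro h
    obtain ⟨φ, hφ, h1, h2⟩ := JordanPair.Inclusion.exists_lieHom hV h
    exact ⟨φ, hφ, h1, h2, JordanPair.isAlgebraOfQuotients_of_isPairOfMQuotients hV h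
      (JordanPair.range_eq_sub h1 h2)⟩
  · rintro ⟨φ, hφ, h1, h2, hQ⟩
    exact JordanPair.isPairOfMQuotients_of_isAlgebraOfQuotients hV hφ h1 h2 hQ
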